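/- **Setting.** An extended metric-topological measure space (e.m.t.m. space) $\mathbb X=(X,\tau,\mathsf d,\mathfrak m)$ consists of a set $X$ with an extended distance $\mathsf d\colon X\times X\to[0,+\infty]$, a Hausdorff topology $\tau$ and a finite Radon (i.e. finite Borel, inner regular by compact sets) measure $\mathfrak m$ on $(X,\tau)$. Let $\mathrm{Lip}_b(X)=\mathrm{Lip}_b(X,\tau,\mathsf d)$ be the algebra of bounded, $\tau$-continuous, $\mathsf d$-Lipschitz functions $f\colon X\to\mathbb R$. Put $\mathrm{Lip}(f,A,\mathsf d)=\sup\{|f(x)-f(y)|/\mathsf d(x,y): x,y\in A,\ x\ne y\}$, $\mathrm{Lip}(f,\mathsf d)=\mathrm{Lip}(f,X,\mathsf d)$, $\|f\|_{C_b}=\sup_X|f|$, $\|f\|_{\mathrm{Lip}_b}=\mathrm{Lip}(f,\mathsf d)+\|f\|_{C_b}$ and $\mathrm{lip}_{\mathsf d}(f)(x)=\inf\{\mathrm{Lip}(f,U,\mathsf d): x\in U\in\tau\}$. It is required that $\tau$ is the initial topology of $\mathrm{Lip}_b(X)$ and that $\mathsf d(x,y)=\sup\{|f(x)-f(y)|: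 f\in \mathrm{Lip}_b(X),\ \mathrm{Lip}(f,\mathsf d)\le 1\}$ for all $x,y\in X$. The *compactification* $\hat{\mathbb X}=(\hat X,\hat\tau,\hat{\mathsf d},\hat{\mathfrak m})$ is given by the set $\hat X$ of characters (nonzero multiplicative continuous linear functionals) of $(\mathrm{Lip}_b(X),\|\cdot\|_{C_b})$, the weak$^*$ topology $\hat\tau$, $\hat{\mathsf d}(\varphi,\psi)=\sup\{|\varphi(f)-\psi(f)|: f\in\mathrm{Lip}_b(X),\ \mathrm{Lip}(f,\mathsf d)\le1\}$ and $\hat{\mathfrak m}=\iota_\#\mathfrak m$, where $\iota\colon X\to\hat X$, $\iota(x)(f)=f(x)$. It is again an e.m.t.m. space. Let $L^0(\mathfrak m)$ be the algebra of $\mathfrak m$-a.e. classes of measurable functions $X\to\mathbb R$, with the a.e. order. Denote by $\iota^*$ both maps $\mathrm{Lip}_b(\hat X)\to\mathrm{Lip}_b(X)$ and $L^0(\hat{\mathfrak m})\to L^0(\mathfrak m)$ given by $\hat f\mapsto\hat f\circ\iota$; the latter is bijective, and $\iota_*\colon L^0(\mathfrak m)\to L^0(\hat{\mathfrak m})$ denotes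 its inverse. A *Lipschitz derivation* on $\mathbb X$ is a linear map $b\colon\mathrm{Lip}_b(X)\to L^0(\mathfrak m)$ with $b(fg)=f\,b(g)+g\,b(f)$; they form the $L^0(\mathfrak m)$-module $\mathrm{Der}(\mathbb X)$. For $b\in\mathrm{Der}(\mathbb X)$: * $b\in D(\mathrm{div};\mathbb X)$ if $b(f)\in L^1(\mathfrak m)$ for all $f\in\mathrm{Lip}_b(X)$ and there is a (unique) $\mathrm{div}(b)\in L^1(\mathfrak m)$ such that $\int b(f)\,d\mathfrak m=-\int f\,\mathrm{div}(b)\,d\mathfrak m$ for all $f\in\mathrm{Lip}_b(X)$. * $b$ is *local* if $b(f)=0$ $\mathfrak m$-a.e. on $\{f=0\}$ for all $f\in\mathrm{Lip}_b(X)$. * $b$ is a *Weaver derivation*, $b\in\mathscr X(\mathbb X)$, if $b(f)\in L^\infty(\mathfrak m)$ for all $f$ and $b$ is sequentially continuous from the closed unit ball of $(\mathrm{Lip}_b(X),\|\cdot\|_{\mathrm{Lip}_b})$ with pointwise convergence to $L^\infty(\mathfrak m)$ with the weak$^*$ topology; then $|b|_W=\bigwedge\{g\in L^\infty(\mathfrak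 m)^+: |b(f)|\le g\|f\|_{\mathrm{Lip}_b}\ \mathfrak m\text{-a.e. for all }f\}$. * $b$ is a *Di Marino derivation*, $b\in\mathrm{Der}^0(\mathbb X)$, if there is $g\in L^0(\mathfrak m)^+$ with $|b(f)|\le g\,\mathrm{lip}_{\mathsf d}(f)$ $\mathfrak m$-a.e. for all $f\in\mathrm{Lip}_b(X)$; $|b|$ is the infimum in $L^0(\mathfrak m)$ of all such $g$. For $q,r\in[1,\infty]$, $b\in\mathrm{Der}^q(\mathbb X)$ if some such $g$ lies in $L^q(\mathfrak m)$, and $b\in\mathrm{Der}^q_r(\mathbb X)$ if moreover $b\in D(\mathrm{div};\mathbb X)$ and $\mathrm{div}(b)\in L^r(\mathfrak m)$. **Proposition 4.15 (Derivations on the compactification).** Let $\mathbb X$ be an e.m.t.m. space with compactification $\hat{\mathbb X}$ and embedding $\iota$. Define $\iota_*\colon\mathrm{Der}(\mathbb X)\to\mathrm{Der}(\hat{\mathbb X})$ by $(\iota_*b)(\hat f)=\iota_*\big(b(\iota^*\hat f)\big)$ for $\hat f\in\mathrm{Lip}_b(\hat X,\hat\tau,\hat{\mathsf d})$. Then $\iota_*$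 is a linear bijection, and $\iota_*(hb)=(\iota_*h)(\iota_*b)$ for all $b\in\mathrm{Der}(\mathbb X)$, $h\in L^0(\mathfrak m)$. Moreover: 1. $\iota_*(D(\mathrm{div};\mathbb X))=D(\mathrm{div};\hat{\mathbb X})$ and $\mathrm{div}(\iota_*b)=\iota_*(\mathrm{div}(b))$ for every $b\in D(\mathrm{div};\mathbb X)$. 2. $\iota_*(\mathscr X(\mathbb X))\subseteq\mathscr X(\hat{\mathbb X})$ and, for every $b\in\mathscr X(\mathbb X)$, the infimum $|b|_W$ exists and $|\iota_*b|_W=\iota_*|b|_W$. 3. A derivation $b\in\mathrm{Der}(\mathbb X)$ is local if and only if $\iota_*b$ is local. 4. $\iota_*(\mathrm{Der}^0(\mathbb X))\subseteq\mathrm{Der}^0(\hat{\mathbb X})$ and, for every $b\in\mathrm{Der}^0(\mathbb X)$, the infimum $|b|$ exists and $|\iota_*b|\le\iota_*|b|$. Moreover $\iota_*(\mathrm{Der}^q(\mathbb X))\subseteq\mathrm{Der}^q(\hat{\mathbb X})$ and $\iota_*(\mathrm{Der}^q_r(\mathbb X))\subseteq\mathrm{Der}^q_r(\hat{\mathbb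 X})$ for all $q,r\in[1,\infty]$. 5. If $\tau$ is metrisable on every $\tau$-compact subset of $X$, then $\iota_*(\mathrm{Der}^q_q(\mathbb X))=\mathrm{Der}^q_q(\hat{\mathbb X})$ for every $q\in[1,\infty]$, and $|\iota_*b|=\iota_*|b|$ for every $b\in\mathrm{Der}^q_q(\mathbb X)$. -/

import Mathlib

open MeasureTheory Filter Topology
open scoped ENNReal NNReal BoundedContinuousFunction

namespace EMT

noncomputable section

/-! ### Bounded continuous Lipschitz functions and extended metric-topological spaces

Throughout, the topology `τ` is the `TopologicalSpace` structure of `X` and the extended distance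
`d` is `edist`; the two are independent data, related only by the axioms of `EMTSpace`. -/

section Space

variable (X : Type*) [TopologicalSpace X] [EDist X]

/-- `Lip_b(X,τ,d)`: the algebra of bounded `τ`-continuous `d`-Lipschitz real functions. As a
subalgebra of `X →ᵇ ℝ` it carries the supremum norm `‖·‖_{C_b}`; its Lipschitz norm is
`lipNorm` below. -/
def lipB : Subalgebra ℝ (X →ᵇ ℝ) where
  carrier := {f | ∃ L : ℝ≥0, ∀ x y : X, edist (f x) (f y) ≤ L * edist x y}
  mul_mem' := by
    rintro f g ⟨L, hL⟩ ⟨M, hM⟩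
    refine ⟨‖f‖₊ * M + ‖g‖₊ * L, fun x y => ?_⟩
    have h1 : edist (f x * g x) (f y * g y) ≤
        ‖f‖₊ * edist (g x) (g y) + ‖g‖₊ * edist (f x) (f y) := by
      have hf := f.norm_coe_le_norm x
      have hg := g.norm_coe_le_norm y
      have e : dist (f x * g x) (f y * g y) ≤
          ‖f‖ * dist (g x) (g y) + ‖g‖ * dist (f x) (f y) := by
        rw [Real.norm_eq_abs] at hf hg
        simp only [Real.dist_eq]
        rw [show f x * g x - f y * g y = f x * (g x - g y) + g y * (f x - f y) by ring]
        refine (abs_add_le _ _).trans ?_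
        rw [abs_mul, abs_mul]
        gcongr
      simp only [edist_nndist]
      exact_mod_cast e
    refine h1.trans ?_
    push_cast
    rw [add_mul, mul_assoc, mul_assoc]
    gcongr
    · exact hM x y
    · exact hL x y
  add_mem' := by
    rintro f g ⟨L, hL⟩ ⟨M, hM⟩
    refine ⟨L + M, fun x y => ?_⟩
    push_cast
    rw [add_mul]
    exact (edist_add_add_le (f x) (g x) (f y) (g y)).trans (add_le_add (hL x y) (hM x y))
  algebraMap_mem' c := ⟨0, fun x y => by simp⟩

variable {X}

/-- `Lip(f,A,d) = sup { |f(x)-f(y)| / d(x,y) : x, y ∈ A, x ≠ y }`. -/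
def lipOn (f : X → ℝ) (A : Set X) : ℝ≥0∞ :=
  ⨆ x ∈ A, ⨆ y ∈ A, ⨆ _ : x ≠ y, edist (f x) (f y) / edist x y

/-- `Lip(f,d)`. -/
def lipConst (f : X → ℝ) : ℝ≥0∞ := lipOn f Set.univ

/-- `‖f‖_{Lip_b} = Lip(f,d) + sup |f|`. -/
def lipNorm (f : lipB X) : ℝ := (lipConst (f : X →ᵇ ℝ)).toReal + ‖(f : X →ᵇ ℝ)‖

/-- The asymptotic slope `lip_d(f)(x) = inf { Lip(f,U,d) : U open, x ∈ U }`. -/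
def slope (f : lipB X) (x : X) : ℝ :=
  (⨅ U : Set X, ⨅ _ : IsOpen U, ⨅ _ : x ∈ U, lipOn (f : X →ᵇ ℝ) U).toReal

theorem lipConst_lt_top (f : lipB X) : lipConst (f : X →ᵇ ℝ) < ∞ := by
  obtain ⟨L, hL⟩ := f.2
  refine lt_of_le_of_lt ?_ (ENNReal.coe_lt_top (r := L))
  simp only [lipConst, lipOn, iSup_le_iff]
  intro x _ y _ _
  exact ENNReal.div_le_of_le_mul (hL x y)

variable (X)

/-- Extended metric-topological spaces: `edist` is an extended distance, `τ` is Hausdorff and is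
the initial topology of `Lip_b(X,τ,d)`, and `d` is recovered from the functions `f` in
`Lip_b(X,τ,d)` with `Lip(f,d) ≤ 1`. -/
class EMTSpace : Prop extends T2Space X where
  dist_self : ∀ x : X, edist x x = 0
  dist_comm : ∀ x y : X, edist x y = edist y x
  dist_triangle : ∀ x y z : X, edist x z ≤ edist x y + edist y z
  eq_of_dist_eq_zero : ∀ x y : X, edist x y = 0 → x = y
  initial : (inferInstance : TopologicalSpace X) =
    ⨅ f : lipB X, TopologicalSpace.induced (fun x => (f : X →ᵇ ℝ) x) inferInstance
  recovery : ∀ x y : X, edist x y =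
    ⨆ f : lipB X, ⨆ _ : lipConst (f : X →ᵇ ℝ) ≤ 1,
      edist ((f : X →ᵇ ℝ) x) ((f : X →ᵇ ℝ) y)

/-! ### The Gelfand compactification -/

/-- The underlying set of the compactification: the characters of `(Lip_b(X,τ,d), ‖·‖_{C_b})`,
that is, the nonzero multiplicative elements of its dual, with the weak* topology. -/
def Compactification : Type _ := WeakDual.characterSpace ℝ (lipB X)

instance : TopologicalSpace (Compactification X) :=
  inferInstanceAs (TopologicalSpace (WeakDual.characterSpace ℝ (lipB X)))

instance : T2Space (Compactification X) :=
  inferInstanceAs (T2Space (WeakDual.characterSpace ℝ (lipB X)))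

variable {X}

/-- The value `φ(f)` of a character at a function. -/
def Compactification.eval (φ : Compactification X) (f : lipB X) : ℝ := φ.1 f

variable (X)

/-- `d̂(φ,ψ) = sup { |φ(f)-ψ(f)| : Lip(f,d) ≤ 1 }`. -/
instance : EDist (Compactification X) where
  edist φ ψ := ⨆ f : lipB X, ⨆ _ : lipConst (f : X →ᵇ ℝ) ≤ 1, edist (φ.eval f) (ψ.eval f)

instance : MeasurableSpace (Compactification X) := borel _

instance : BorelSpace (Compactification X) := ⟨rfl⟩

variable {X}

/-- The canonical embedding `ι(x)(f) = f(x)`. -/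
def emb (x : X) : Compactification X :=
  ⟨(({ toFun := fun f => (f : X →ᵇ ℝ) x
       map_add' := fun _ _ => rfl
       map_smul' := fun _ _ => rfl
       cont := (BoundedContinuousFunction.evalCLM ℝ x).continuous.comp continuous_subtype_val }
      : lipB X →L[ℝ] ℝ) : WeakDual ℝ (lipB X)),
    fun h => one_ne_zero (congrArg (fun φ : WeakDual ℝ (lipB X) => φ 1) h),
    fun _ _ => rfl⟩

theorem emb_eval (x : X) (f : lipB X) : (emb x).eval f = (f : X →ᵇ ℝ) x := rfl

theorem Compactification.continuous_eval (f : lipB X) :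
    Continuous fun φ : Compactification X => φ.eval f :=
  (WeakDual.eval_continuous f).comp continuous_subtype_val

theorem continuous_emb : Continuous (emb : X → Compactification X) :=
  continuous_induced_rng.2
    (WeakDual.continuous_of_continuous_eval fun f => (f : X →ᵇ ℝ).continuous)

theorem edist_emb [EMTSpace X] (x y : X) : edist (emb x) (emb y) = edist x y :=
  (EMTSpace.recovery x y).symm

theorem emb_injective [EMTSpace X] : Function.Injective (emb : X → Compactification X) := by
  intro x y h
  apply EMTSpace.eq_of_dist_eq_zero
  rw [← edist_emb, h]
  exact le_antisymm (iSup₂_le fun f _ => by simp) zero_le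

theorem lipConst_le {X : Type*} [EDist X] {f : X → ℝ} {L : ℝ≥0∞} (h : ∀ x y, edist (f x) (f y) ≤ L * edist x y) :
    lipConst f ≤ L := by
  simp only [lipConst, lipOn, iSup_le_iff]
  exact fun x _ y _ _ => ENNReal.div_le_of_le_mul (h x y)

theorem Compactification.edist_eval_le {f : lipB X} (hf : lipConst (f : X →ᵇ ℝ) ≤ 1)
    (φ ψ : Compactification X) : edist (φ.eval f) (ψ.eval f) ≤ edist φ ψ :=
  le_iSup₂_of_le (f := fun (f : lipB X) (_ : lipConst (f : X →ᵇ ℝ) ≤ 1) =>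
    edist (φ.eval f) (ψ.eval f)) f hf le_rfl

theorem Compactification.eval_smul (φ : Compactification X) (c : ℝ) (f : lipB X) :
    φ.eval (c • f) = c * φ.eval f := map_smul φ.1 c f

theorem Compactification.exists_lipschitz_eval (f : lipB X) :
    ∃ L : ℝ≥0, ∀ φ ψ : Compactification X,
      edist (φ.eval f) (ψ.eval f) ≤ L * edist φ ψ := by
  obtain ⟨L, hL⟩ := f.2
  refine ⟨L + 1, fun φ ψ => ?_⟩
  have h0 : (L + 1 : ℝ≥0) ≠ 0 := by positivity
  have hs : ∀ a b : ℝ, edist ((((L + 1)⁻¹ : ℝ≥0) : ℝ) * a) ((((L + 1)⁻¹ : ℝ≥0) : ℝ) * b)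
      = ((L + 1)⁻¹ : ℝ≥0) * edist a b := fun a b => by
    have := edist_smul₀ (((L + 1)⁻¹ : ℝ≥0) : ℝ) a b
    rwa [Real.nnnorm_of_nonneg (NNReal.coe_nonneg _), smul_eq_mul, smul_eq_mul] at this
  have h1 : lipConst (((((L + 1)⁻¹ : ℝ≥0) : ℝ) • f : lipB X) : X →ᵇ ℝ) ≤ 1 := by
    refine lipConst_le fun x y => ?_
    change edist ((((L + 1)⁻¹ : ℝ≥0) : ℝ) * (f : X →ᵇ ℝ) x)
      ((((L + 1)⁻¹ : ℝ≥0) : ℝ) * (f : X →ᵇ ℝ) y) ≤ _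
    rw [hs, one_mul]
    calc ((L + 1)⁻¹ : ℝ≥0) * edist ((f : X →ᵇ ℝ) x) ((f : X →ᵇ ℝ) y)
        ≤ ((L + 1)⁻¹ : ℝ≥0) * ((L + 1 : ℝ≥0) * edist x y) := by
          gcongr
          refine (hL x y).trans ?_
          gcongr
          exact_mod_cast le_self_add
      _ = edist x y := by
          rw [← mul_assoc, ← ENNReal.coe_mul, inv_mul_cancel₀ h0, ENNReal.coe_one, one_mul]
  have h2 := edist_eval_le h1 φ ψ
  rw [eval_smul, eval_smul, hs] at h2
  calc edist (φ.eval f) (ψ.eval f)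
      = (L + 1 : ℝ≥0) * (((L + 1)⁻¹ : ℝ≥0) * edist (φ.eval f) (ψ.eval f)) := by
        rw [← mul_assoc, ← ENNReal.coe_mul, mul_inv_cancel₀ h0, ENNReal.coe_one, one_mul]
    _ ≤ (L + 1 : ℝ≥0) * edist φ ψ := by gcongr

theorem Compactification.abs_eval_le (φ : Compactification X) (f : lipB X) :
    |φ.eval f| ≤ ‖f‖ := by
  by_contra! h
  have h0 : φ.eval f ≠ 0 := abs_pos.1 ((norm_nonneg f).trans_lt h)
  have hg : ‖(φ.eval f)⁻¹ • f‖ < 1 := by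
    change ‖(φ.eval f)⁻¹ • (f : X →ᵇ ℝ)‖ < 1
    rw [norm_smul, norm_inv, Real.norm_eq_abs, inv_mul_lt_one₀ (abs_pos.2 h0)]
    exact h
  have h1 : ∀ n : ℕ, φ.eval (((φ.eval f)⁻¹ • f) ^ (n + 1)) = 1 := by
    have hb : φ.eval ((φ.eval f)⁻¹ • f) = 1 := by rw [eval_smul, inv_mul_cancel₀ h0]
    intro n
    induction n with
    | zero => rw [zero_add, pow_one, hb]
    | succ n ih =>
      rw [pow_succ, show ∀ u v, φ.eval (u * v) = φ.eval u * φ.eval v from φ.2.2, ih, hb, one_mul]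
  have h2 : Tendsto (fun n : ℕ => φ.eval (((φ.eval f)⁻¹ • f) ^ (n + 1))) atTop
      (𝓝 (φ.eval 0)) :=
    (φ.1.cont.tendsto 0).comp
      ((tendsto_add_atTop_iff_nat 1).2 (tendsto_pow_atTop_nhds_zero_of_norm_lt_one hg))
  simp only [h1] at h2
  have h3 : φ.eval 0 = 0 := map_zero φ.1
  rw [h3] at h2
  exact one_ne_zero (tendsto_nhds_unique tendsto_const_nhds h2)

/-- The Gelfand transform `Γ(f)(φ) = φ(f)`. -/
def gelfand (f : lipB X) : lipB (Compactification X) :=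
  ⟨BoundedContinuousFunction.ofNormedAddCommGroup (fun φ : Compactification X => φ.eval f)
    (Compactification.continuous_eval f) ‖f‖ fun φ => φ.abs_eval_le f,
    Compactification.exists_lipschitz_eval f⟩

theorem gelfand_apply (f : lipB X) (φ : Compactification X) :
    (gelfand f : Compactification X →ᵇ ℝ) φ = φ.eval f := rfl

theorem Compactification.eq_of_edist_eq_zero {φ ψ : Compactification X} (h : edist φ ψ = 0) :
    φ = ψ := by
  refine Subtype.ext (DFunLike.ext _ _ fun f => ?_)
  obtain ⟨L, hL⟩ := exists_lipschitz_eval f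
  have := hL φ ψ
  rw [h, mul_zero, nonpos_iff_eq_zero] at this
  exact edist_eq_zero.1 this

/-- The compactification of an e.m.t. space is an e.m.t. space. -/
instance : EMTSpace (Compactification X) where
  dist_self φ := le_antisymm (iSup₂_le fun f _ => by simp) zero_le
  dist_comm φ ψ := iSup_congr fun f => iSup_congr fun _ => edist_comm _ _
  dist_triangle φ ψ χ := iSup₂_le fun f hf => (edist_triangle _ (ψ.eval f) _).trans
    (add_le_add (Compactification.edist_eval_le hf _ _) (Compactification.edist_eval_le hf _ _))
  eq_of_dist_eq_zero _ _ := Compactification.eq_of_edist_eq_zero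
  initial := by
    refine le_antisymm
      (le_iInf fun F => (F : Compactification X →ᵇ ℝ).continuous.le_induced) ?_
    have e : instTopologicalSpaceCompactification X = TopologicalSpace.induced
        (fun (φ : Compactification X) (f : lipB X) => φ.eval f) Pi.topologicalSpace :=
      induced_compose
    refine le_trans ?_ (e.trans (by rw [Pi.topologicalSpace, induced_iInf])).ge
    refine le_iInf fun f => ?_
    rw [induced_compose]
    exact iInf_le (fun F : lipB (Compactification X) => TopologicalSpace.induced
      (fun φ => (F : Compactification X →ᵇ ℝ) φ) inferInstance) (gelfand f)
  recovery φ ψ := by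
    refine le_antisymm (iSup₂_le fun f hf => ?_) (iSup₂_le fun F hF => ?_)
    · refine le_iSup₂_of_le (gelfand f) (lipConst_le fun φ ψ => ?_) le_rfl
      rw [one_mul]
      exact Compactification.edist_eval_le hf φ ψ
    · rcases eq_or_ne φ ψ with rfl | hne
      · simp
      have h1 : edist ((F : Compactification X →ᵇ ℝ) φ) ((F : Compactification X →ᵇ ℝ) ψ)
          / edist φ ψ ≤ 1 := by
        refine le_trans ?_ hF
        simp only [lipConst, lipOn, Set.mem_univ, iSup_pos]
        exact le_iSup_of_le φ (le_iSup_of_le ψ (le_iSup_of_le hne le_rfl))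
      have h0 : edist φ ψ ≠ 0 := fun h => hne (Compactification.eq_of_edist_eq_zero h)
      rcases eq_or_ne (edist φ ψ) ∞ with ht | ht
      · rw [ht]; exact le_top
      · rwa [ENNReal.div_le_iff h0 ht, one_mul] at h1

end Space

/-! ### The algebra `L⁰(m)` and Lipschitz derivations -/

section Derivations

variable {X : Type*} [MeasurableSpace X] {m : Measure X}

/-- Pointwise a.e. operations make `L⁰(m)` a commutative ring. -/
instance : CommRing (X →ₘ[m] ℝ) :=
  { (inferInstance : AddCommGroup (X →ₘ[m] ℝ)), (inferInstance : CommMonoid (X →ₘ[m] ℝ)) with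
    left_distrib := fun a b c => AEEqFun.toGerm_injective <| by
      simp only [AEEqFun.mul_toGerm, AEEqFun.add_toGerm, mul_add]
    right_distrib := fun a b c => AEEqFun.toGerm_injective <| by
      simp only [AEEqFun.mul_toGerm, AEEqFun.add_toGerm, add_mul]
    zero_mul := fun a => AEEqFun.toGerm_injective <| by
      simp only [AEEqFun.mul_toGerm, AEEqFun.zero_toGerm, zero_mul]
    mul_zero := fun a => AEEqFun.toGerm_injective <| by
      simp only [AEEqFun.mul_toGerm, AEEqFun.zero_toGerm, mul_zero] }

instance : SMulCommClass ℝ (X →ₘ[m] ℝ) (X →ₘ[m] ℝ) where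
  smul_comm c h u := by
    induction h, u using AEEqFun.induction_on₂ with
    | _ h hh u hu =>
      rw [smul_eq_mul, smul_eq_mul, AEEqFun.mk_mul_mk, AEEqFun.smul_mk, AEEqFun.smul_mk,
        AEEqFun.mk_mul_mk]
      simp only [mul_smul_comm]

variable [TopologicalSpace X] [EDist X] [BorelSpace X]

/-- The class in `L⁰(m)` of a function in `Lip_b(X,τ,d)`. -/
def lipToL0 : lipB X →+* (X →ₘ[m] ℝ) where
  toFun f := AEEqFun.mk (f : X →ᵇ ℝ) (f : X →ᵇ ℝ).continuous.aestronglyMeasurable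
  map_one' := rfl
  map_mul' _ _ := rfl
  map_zero' := rfl
  map_add' _ _ := rfl

/-- `f • u` is the pointwise a.e. product `f u`. -/
instance : Module (lipB X) (X →ₘ[m] ℝ) :=
  Module.compHom (X →ₘ[m] ℝ) (lipToL0 (m := m))

theorem lip_smul_def (f : lipB X) (u : X →ₘ[m] ℝ) : f • u = lipToL0 f * u := rfl

instance : SMulCommClass (X →ₘ[m] ℝ) (lipB X) (X →ₘ[m] ℝ) where
  smul_comm h f u := by
    simp only [lip_smul_def, smul_eq_mul, mul_left_comm]

instance : SMulCommClass ℝ (lipB X) (X →ₘ[m] ℝ) where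
  smul_comm c f u := by
    simp only [lip_smul_def]
    exact smul_comm c (lipToL0 (m := m) f) u

variable (m)

/-- Lipschitz derivations: `ℝ`-linear maps `b : Lip_b(X,τ,d) → L⁰(m)` satisfying the Leibniz rule
`b(fg) = f b(g) + g b(f)`. They form a module over `L⁰(m)` with `(h b)(f) = h b(f)`. -/
abbrev Der : Type _ := Derivation ℝ (lipB X) (X →ₘ[m] ℝ)

variable {m}

/-! #### Divergence -/

/-- `v` is a divergence of `b`. -/
def IsDivergence (b : Der m) (v : X →ₘ[m] ℝ) : Prop :=
  (∀ f, Integrable (b f) m) ∧ Integrable v m ∧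
    ∀ f : lipB X, ∫ x, b f x ∂m = -∫ x, (f : X →ᵇ ℝ) x * v x ∂m

variable (m) in
/-- `D(div;X)`: the derivations having divergence. -/
def divDomain : Set (Der m) := {b | ∃ v, IsDivergence b v}

open Classical in
/-- `div(b)`, for `b` in `D(div;X)` (and `0` otherwise). -/
def divergence (b : Der m) : X →ₘ[m] ℝ :=
  if h : ∃ v, IsDivergence b v then h.choose else 0

/-! #### Locality -/

/-- `b` is local: `b(f) = 0` a.e. on `{f = 0}`. -/
def IsLocal (b : Der m) : Prop :=
  ∀ f : lipB X, ∀ᵐ x ∂m, (f : X →ᵇ ℝ) x = 0 → b f x = 0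

/-! #### Weaver derivations -/

open Classical in
/-- The infimum of a set in the ordered space `L⁰(m)`, when it exists (and `0` otherwise). -/
def infL0 (S : Set (X →ₘ[m] ℝ)) : X →ₘ[m] ℝ :=
  if h : ∃ g, IsGLB S g then h.choose else 0

variable (m) in
/-- Weaver derivations: `b` takes values in `L^∞(m)` and is sequentially continuous from the
closed unit ball of `Lip_b(X,τ,d)` with the topology of pointwise convergence to `L^∞(m)` with
the weak* topology (as the dual of `L¹(m)`). -/
def weaver : Set (Der m) :=
  {b | (∀ f, MemLp (b f) ∞ m) ∧
    ∀ (F : ℕ → lipB X) (f : lipB X), (∀ n, lipNorm (F n) ≤ 1) → lipNorm f ≤ 1 →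
      (∀ x, Tendsto (fun n => (F n : X →ᵇ ℝ) x) atTop (𝓝 ((f : X →ᵇ ℝ) x))) →
      ∀ h : X → ℝ, Integrable h m →
        Tendsto (fun n => ∫ x, h x * b (F n) x ∂m) atTop (𝓝 (∫ x, h x * b f x ∂m))}

/-- The `g ∈ L^∞(m)⁺` such that `|b(f)| ≤ g ‖f‖_{Lip_b}` a.e. for every `f`. -/
def weaverBounds (b : Der m) : Set (X →ₘ[m] ℝ) :=
  {g | 0 ≤ g ∧ MemLp g ∞ m ∧ ∀ f : lipB X, ∀ᵐ x ∂m, |b f x| ≤ g x * lipNorm f}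

/-- `|b|_W`. -/
def weaverNorm (b : Der m) : X →ₘ[m] ℝ := infL0 (weaverBounds b)

/-! #### Di Marino derivations -/

/-- The `g ∈ L⁰(m)⁺` such that `|b(f)| ≤ g lip_d(f)` a.e. for every `f`. -/
def diMarinoBounds (b : Der m) : Set (X →ₘ[m] ℝ) :=
  {g | 0 ≤ g ∧ ∀ f : lipB X, ∀ᵐ x ∂m, |b f x| ≤ g x * slope f x}

/-- `|b|`. -/
def diMarinoNorm (b : Der m) : X →ₘ[m] ℝ := infL0 (diMarinoBounds b)

variable (m)

/-- `Der⁰(X)`: the Di Marino derivations. -/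
def der0 : Set (Der m) := {b | ∃ g, g ∈ diMarinoBounds b}

/-- `Der^q(X)`. -/
def derQ (q : ℝ≥0∞) : Set (Der m) := {b | ∃ g ∈ diMarinoBounds b, MemLp g q m}

/-- `Der^q_r(X)`. -/
def derQR (q r : ℝ≥0∞) : Set (Der m) :=
  {b | b ∈ derQ m q ∧ b ∈ divDomain m ∧ MemLp (divergence b) r m}

end Derivations

/-! ### Push-forward to the compactification -/

section Push

variable {X : Type*} [TopologicalSpace X] [EDist X] [MeasurableSpace X] [BorelSpace X]

/-- `m̂ = ι_# m`. -/
def hatMeasure (m : Measure X) : Measure (Compactification X) := m.map emb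

theorem measurePreserving_emb (m : Measure X) :
    MeasurePreserving (emb : X → Compactification X) m (hatMeasure m) :=
  ⟨continuous_emb.measurable, rfl⟩

instance (m : Measure X) [IsFiniteMeasure m] : IsFiniteMeasure (hatMeasure m) :=
  inferInstanceAs (IsFiniteMeasure (m.map emb))

instance (m : Measure X) [m.InnerRegular] : (hatMeasure m).InnerRegular :=
  Measure.InnerRegular.map_of_continuous continuous_emb

variable {m : Measure X}

/-- `ι^* : L⁰(m̂) → L⁰(m)`, `f̂ ↦ f̂ ∘ ι`. -/
def pullL0 : (Compactification X →ₘ[hatMeasure m] ℝ) →+* (X →ₘ[m] ℝ) where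
  toFun u := u.compMeasurePreserving emb (measurePreserving_emb m)
  map_one' := rfl
  map_zero' := rfl
  map_mul' u v := by
    induction u, v using AEEqFun.induction_on₂
    rfl
  map_add' u v := by
    induction u, v using AEEqFun.induction_on₂
    rfl

theorem pullL0_smul (c : ℝ) (u : Compactification X →ₘ[hatMeasure m] ℝ) :
    pullL0 (c • u) = c • pullL0 u := by
  induction u using AEEqFun.induction_on
  rfl

theorem pullL0_injective :
    Function.Injective (pullL0 : (Compactification X →ₘ[hatMeasure m] ℝ) →+* (X →ₘ[m] ℝ)) := by
  intro u v h
  have h1 := AEEqFun.coeFn_compMeasurePreserving u (measurePreserving_emb m)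
  have h2 := AEEqFun.coeFn_compMeasurePreserving v (measurePreserving_emb m)
  have h3 : u.compMeasurePreserving emb (measurePreserving_emb m) =
    v.compMeasurePreserving emb (measurePreserving_emb m) := h
  rw [← h3] at h2
  refine AEEqFun.ext ?_
  have hS : MeasurableSet {φ | u φ = v φ} := measurableSet_eq_fun u.measurable v.measurable
  refine (ae_map_iff continuous_emb.aemeasurable hS).2 ?_
  filter_upwards [h1, h2] with x hx1 hx2
  exact hx1.symm.trans hx2

theorem pullL0_surjective [EMTSpace X] [IsFiniteMeasure m] [m.InnerRegular] :
    Function.Surjective (pullL0 : (Compactification X →ₘ[hatMeasure m] ℝ) →+* (X →ₘ[m] ℝ)) := by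
  intro u
  have hK : ∀ n : ℕ, ∃ K : Set X, IsCompact K ∧ m Kᶜ < ((n : ℝ≥0∞) + 1)⁻¹ := fun n => by
    obtain ⟨K, -, hK, hlt⟩ := MeasurableSet.univ.exists_isCompact_sdiff_lt
      (measure_ne_top m Set.univ) (ε := ((n : ℝ≥0∞) + 1)⁻¹) (by simp)
    exact ⟨K, hK, by rwa [Set.compl_eq_univ_sdiff]⟩
  choose K hK hlt using hK
  have hnull : m (⋃ n, K n)ᶜ = 0 := by
    refine le_antisymm (le_of_forall_gt fun ε hε => ?_) zero_le
    obtain ⟨n, hn⟩ := ENNReal.exists_inv_nat_lt hε.ne'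
    refine (measure_mono (Set.compl_subset_compl.2 (Set.subset_iUnion K n))).trans_lt
      ((hlt n).trans (lt_of_le_of_lt ?_ hn))
    exact ENNReal.inv_le_inv.2 le_self_add
  have hKm : ∀ n, MeasurableSet (K n) := fun n => (hK n).measurableSet
  have hemb : ∀ n, MeasurableEmbedding fun x : K n => (emb (x : X) : Compactification X) := by
    intro n
    have := isCompact_iff_compactSpace.1 (hK n)
    exact ((continuous_emb.comp continuous_subtype_val).isClosedEmbedding
      (emb_injective.comp Subtype.val_injective)).measurableEmbedding
  have hE : MeasurableEmbedding
      fun x : (⋃ n, K n : Set X) => (emb (x : X) : Compactification X) := by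
    refine ⟨emb_injective.comp Subtype.val_injective,
      continuous_emb.measurable.comp measurable_subtype_coe, fun s hs => ?_⟩
    have e : (fun x : (⋃ n, K n : Set X) => (emb (x : X) : Compactification X)) '' s =
        ⋃ n, (fun x : K n => (emb (x : X) : Compactification X)) ''
          {x : K n | (x : X) ∈ Subtype.val '' s} := by
      ext φ
      simp only [Set.mem_image, Set.mem_iUnion, Set.mem_ofPred_eq, Subtype.exists]
      constructor
      · rintro ⟨x, ⟨n, hn⟩, hxs, rfl⟩
        exact ⟨n, x, hn, ⟨x, ⟨n, hn⟩, hxs, rfl⟩, rfl⟩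
      · rintro ⟨n, x, hn, ⟨y, hy, hys, rfl⟩, rfl⟩
        exact ⟨y, hy, hys, rfl⟩
    rw [e]
    refine MeasurableSet.iUnion fun n => (hemb n).measurableSet_image' ?_
    exact measurable_subtype_coe
      ((MeasurableEmbedding.subtype_coe (MeasurableSet.iUnion hKm)).measurableSet_image' hs)
  obtain ⟨v, hv, hvu⟩ := hE.exists_measurable_extend
    (u.measurable.comp measurable_subtype_coe : Measurable fun x : (⋃ n, K n : Set X) => u x)
    fun _ => inferInstance
  refine ⟨AEEqFun.mk v hv.aestronglyMeasurable, ?_⟩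
  refine AEEqFun.ext ?_
  refine (AEEqFun.coeFn_mk (v ∘ emb)
    (hv.comp continuous_emb.measurable).aestronglyMeasurable).trans ?_
  filter_upwards [measure_eq_zero_iff_ae_notMem.1 hnull] with x hx
  exact congrFun hvu ⟨x, not_not.1 hx⟩

variable [EMTSpace X]

/-- `ι^* : Lip_b(X̂) → Lip_b(X)`, `f̂ ↦ f̂ ∘ ι`. -/
def pullLip : lipB (Compactification X) →ₐ[ℝ] lipB X where
  toFun F := ⟨(F : Compactification X →ᵇ ℝ).compContinuous ⟨emb, continuous_emb⟩, by
    obtain ⟨L, hL⟩ := F.2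
    exact ⟨L, fun x y => (hL (emb x) (emb y)).trans_eq (by rw [edist_emb])⟩⟩
  map_one' := rfl
  map_mul' _ _ := rfl
  map_zero' := rfl
  map_add' _ _ := rfl
  commutes' _ := rfl

variable [IsFiniteMeasure m] [m.InnerRegular]

/-- `ι_* : L⁰(m) → L⁰(m̂)`, the inverse of `ι^*`. -/
def pushL0 : (X →ₘ[m] ℝ) ≃+* (Compactification X →ₘ[hatMeasure m] ℝ) :=
  (RingEquiv.ofBijective pullL0 ⟨pullL0_injective, pullL0_surjective⟩).symm

theorem pullL0_pushL0 (u : X →ₘ[m] ℝ) : pullL0 (pushL0 u) = u :=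
  RingEquiv.apply_symm_apply (RingEquiv.ofBijective pullL0 _) u

/-- `(ι_* b)(f̂) = ι_*(b(ι^* f̂))`. -/
def pushDer (b : Der m) : Der (hatMeasure m) :=
  Derivation.mk'
    { toFun := fun F => pushL0 (b (pullLip F))
      map_add' := fun F G => by rw [map_add, map_add, map_add]
      map_smul' := fun c F => pullL0_injective <| by
        rw [RingHom.id_apply, pullL0_smul, pullL0_pushL0, pullL0_pushL0, map_smul, Derivation.map_smul] }
    fun F G => pullL0_injective <| by
      have e : ∀ H : lipB (Compactification X),
          pullL0 (m := m) (lipToL0 H) = lipToL0 (pullLip H) := fun _ => rfl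
      simp only [LinearMap.coe_mk, AddHom.coe_mk, map_add, map_mul, pullL0_pushL0, lip_smul_def,
        Derivation.leibniz, e]

theorem pushDer_apply (b : Der m) (F : lipB (Compactification X)) :
    pushDer b F = pushL0 (b (pullLip F)) := rfl

end Push

end

end EMT

namespace EMT

/-! ### Characters of `Lip_b(X)`: positivity and density of the evaluations. -/

section Embedding

variable {X : Type*} [TopologicalSpace X] [EDist X]

/-! Restriction along `ι` identifies `Lip_b(X̂)` with `Lip_b(X)`. The inverse is the Gelfand
transform, because characters are positive and so `ι(X)` is dense in `X̂`. Both summands of the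
Lipschitz norm are preserved, since `d̂` is by definition the supremum over the 1-Lipschitz
functions of `X`. As `L⁰(m̂)` and `L⁰(m)` are also identified, as rings, as ordered sets and for
integrals and `L^q` membership, every notion expressed through the algebra, a.e. statements,
integrals and the Lipschitz norm transfers at once: derivations, divergence, locality, Weaver
bounds.

Two notions see more than this. Pointwise convergence on `X̂` is a stronger requirement than on `X`,
so Weaver derivations are only pushed forward. The slope uses neighbourhoods: one in `X̂` pulls back
to one in `X`, whence `slope (F ∘ ι) ≤ (slope F) ∘ ι` (`slope_pullLip_le`), and Di Marino bounds too
are only pushed forward.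

In part (v) the divergence supplies the way back (`pullL0_mem_diMarinoBounds`). Let `g` be an
integrable Di Marino bound of `ι_* b`. Then `|b f| ≤ g L` for globally `L`-Lipschitz `f`, and `b` is
insensitive to truncation away from the truncated set (`ae_truncate_eq`). Integration by parts makes
`b` weakly continuous along equi-Lipschitz functions tending uniformly to 0
(`exists_abs_setIntegral_le`). If `f` is only `c`-Lipschitz on a compact `K`, a lattice
Stone-Weierstrass argument yields globally `c`-Lipschitz `w` uniformly close to `f` on `K`.
Truncating `f - w` at a small height leaves it unchanged on `K`, and weak continuity gives `|b f| ≤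
g c` on `K` (`ae_abs_le_on_isCompact`). Inner regularity passes from compact sets to open sets,
hence to the slope.

The norms exist as infima because the sets of bounds are closed under binary minima
(`exists_isGLB_of_infClosed`). For Weaver derivations nonemptiness of that set comes from
Banach-Steinhaus. -/

theorem Compactification.eval_sub (φ : Compactification X) (f g : lipB X) :
    φ.eval (f - g) = φ.eval f - φ.eval g := map_sub φ.1 f g

theorem Compactification.eval_mul (φ : Compactification X) (f g : lipB X) :
    φ.eval (f * g) = φ.eval f * φ.eval g := φ.2.2 f g

theorem Compactification.eval_sum {ι : Type*} (φ : Compactification X) (s : Finset ι)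
    (f : ι → lipB X) : φ.eval (∑ i ∈ s, f i) = ∑ i ∈ s, φ.eval (f i) := map_sum φ.1 f s

theorem Compactification.eval_one (φ : Compactification X) : φ.eval 1 = 1 := by
  have hmul : φ.eval 1 * φ.eval 1 = φ.eval 1 := by rw [← eval_mul, one_mul]
  refine mul_left_cancel₀ (fun h => φ.2.1 (DFunLike.ext _ _ fun f => ?_))
    (hmul.trans (mul_one _).symm)
  change φ.eval f = 0
  rw [← one_mul f, eval_mul, h, zero_mul]

/-- Characters are monotone. -/
theorem Compactification.le_eval (φ : Compactification X) {f : lipB X} {ε : ℝ}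
    (hf : ∀ x, ε ≤ (f : X →ᵇ ℝ) x) : ε ≤ φ.eval f := by
  -- Since `M • 1 - f` takes values in `[0, M - ε]`, contractivity gives `M - φ(f) ≤ M - ε`. The
  -- maximum with `ε` only keeps `M - ε` nonnegative when `X` is empty.
  set M : ℝ := max ‖f‖ ε
  have h1 : ‖M • (1 : lipB X) - f‖ ≤ M - ε := by
    change ‖M • (1 : X →ᵇ ℝ) - (f : X →ᵇ ℝ)‖ ≤ M - ε
    refine (BoundedContinuousFunction.norm_le (sub_nonneg.2 (le_max_right _ _))).2 fun x => ?_
    have h2 : (f : X →ᵇ ℝ) x ≤ ‖f‖ :=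
      (le_abs_self _).trans ((f : X →ᵇ ℝ).norm_coe_le_norm x)
    have h3 : ‖f‖ ≤ M := le_max_left _ _
    have h4 := hf x
    simp only [BoundedContinuousFunction.coe_sub, BoundedContinuousFunction.coe_smul,
      BoundedContinuousFunction.coe_one, Pi.sub_apply, Pi.one_apply, smul_eq_mul, mul_one,
      Real.norm_eq_abs]
    rw [abs_of_nonneg (by linarith)]
    linarith
  have h2 := (le_abs_self _).trans ((φ.abs_eval_le _).trans h1)
  rw [eval_sub, eval_smul, eval_one, mul_one] at h2
  linarith

/-- A basic neighbourhood of `φ` constrains finitely many `f`. The sum of the squares `(f - φ(f))²`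
is killed by `φ`, so by positivity it cannot be bounded below by `δ² > 0`; a point where it is
smaller than `δ²` evaluates inside the neighbourhood. -/
theorem denseRange_emb : DenseRange (emb : X → Compactification X) := by
  intro φ
  have e : instTopologicalSpaceCompactification X = TopologicalSpace.induced
      (fun (φ : Compactification X) (f : lipB X) => φ.eval f) Pi.topologicalSpace :=
    induced_compose
  rw [mem_closure_iff_nhds]
  intro U hU
  rw [e, nhds_induced, mem_comap] at hU
  obtain ⟨V, hV, hVU⟩ := hU
  rw [nhds_pi, Filter.mem_pi] at hV
  obtain ⟨I, hI, t, ht, htV⟩ := hV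
  have ht' : ∀ f : lipB X, ∃ ε : ℝ, 0 < ε ∧ ∀ r : ℝ, |r - φ.eval f| < ε → r ∈ t f := by
    intro f
    obtain ⟨ε, hε, h⟩ := Metric.mem_nhds_iff.1 (ht f)
    exact ⟨ε, hε, fun r hr => h hr⟩
  choose ε hε0 hε using ht'
  set J := hI.toFinset
  obtain ⟨δ, hδ0, hδ⟩ : ∃ δ : ℝ, 0 < δ ∧ ∀ f ∈ J, δ ≤ ε f := by
    rcases J.eq_empty_or_nonempty with h | h
    · exact ⟨1, one_pos, by simp [h]⟩
    · obtain ⟨f0, -, hf0⟩ := J.exists_min_image ε h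
      exact ⟨ε f0, hε0 f0, hf0⟩
  set k : lipB X → lipB X := fun f => f - φ.eval f • (1 : lipB X)
  set g : lipB X := ∑ f ∈ J, k f * k f
  have hg0 : φ.eval g = 0 := by
    rw [Compactification.eval_sum]
    refine Finset.sum_eq_zero fun f _ => ?_
    rw [Compactification.eval_mul, Compactification.eval_sub, Compactification.eval_smul,
      Compactification.eval_one, mul_one, sub_self, mul_zero]
  have hk : ∀ f x, (k f : X →ᵇ ℝ) x = (f : X →ᵇ ℝ) x - φ.eval f := by
    intro f x
    change (f : X →ᵇ ℝ) x - φ.eval f * 1 = _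
    rw [mul_one]
  have hgx : ∀ x, (g : X →ᵇ ℝ) x = ∑ f ∈ J, ((f : X →ᵇ ℝ) x - φ.eval f) ^ 2 := by
    intro x
    rw [← emb_eval, Compactification.eval_sum]
    refine Finset.sum_congr rfl fun f _ => ?_
    rw [Compactification.eval_mul, emb_eval, hk, sq]
  obtain ⟨x, hx⟩ : ∃ x, (g : X →ᵇ ℝ) x < δ ^ 2 := by
    by_contra! h
    have := φ.le_eval h
    rw [hg0] at this
    exact absurd (pow_pos hδ0 2) this.not_gt
  refine ⟨emb x, hVU (htV fun f hf => hε f _ ?_), x, rfl⟩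
  have hfJ : f ∈ J := hI.mem_toFinset.2 hf
  refine lt_of_lt_of_le ?_ (hδ f hfJ)
  refine abs_lt_of_sq_lt_sq (lt_of_le_of_lt ?_ hx) hδ0.le
  rw [hgx]
  exact Finset.single_le_sum (f := fun f : lipB X => ((f : X →ᵇ ℝ) x - φ.eval f) ^ 2)
    (fun _ _ => sq_nonneg _) hfJ

/-- Pairs at infinite distance contribute 0 to `lipOn`, so their values are unconstrained. The bound
then rests on `L * ∞ = ∞`, which is why `L ≠ 0` is needed here and in the lemmas below. -/
theorem edist_le_of_lipOn_le {X : Type*} [TopologicalSpace X] [EDist X] [EMTSpace X] {f : X → ℝ}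
    {A : Set X} {L : ℝ≥0} (hL : L ≠ 0) (h : lipOn f A ≤ L) {x y : X} (hx : x ∈ A) (hy : y ∈ A) :
    edist (f x) (f y) ≤ L * edist x y := by
  rcases eq_or_ne x y with rfl | hne
  · simp
  have h1 : edist (f x) (f y) / edist x y ≤ L :=
    (le_iSup₂_of_le x hx (le_iSup₂_of_le y hy
      (le_iSup (fun _ : x ≠ y => edist (f x) (f y) / edist x y) hne))).trans h
  rcases eq_or_ne (edist x y) ∞ with ht | ht
  · rw [ht, ENNReal.mul_top (by simpa using hL)]
    exact le_top
  · rwa [ENNReal.div_le_iff (fun h0 => hne (EMTSpace.eq_of_dist_eq_zero _ _ h0)) ht] at h1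

/-- The rescaled function `L⁻¹ f` competes in the supremum defining `d̂`. Keeping the exact constant
is what makes the Gelfand transform preserve Lipschitz constants. -/
theorem Compactification.edist_eval_le_mul {f : lipB X} {L : ℝ≥0} (hL0 : L ≠ 0)
    (hL : ∀ x y, edist ((f : X →ᵇ ℝ) x) ((f : X →ᵇ ℝ) y) ≤ L * edist x y)
    (φ ψ : Compactification X) : edist (φ.eval f) (ψ.eval f) ≤ L * edist φ ψ := by
  have hs : ∀ a b : ℝ, edist (((L⁻¹ : ℝ≥0) : ℝ) * a) (((L⁻¹ : ℝ≥0) : ℝ) * b)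
      = (L⁻¹ : ℝ≥0) * edist a b := fun a b => by
    have := edist_smul₀ ((L⁻¹ : ℝ≥0) : ℝ) a b
    rwa [Real.nnnorm_of_nonneg (NNReal.coe_nonneg _), smul_eq_mul, smul_eq_mul] at this
  have h1 : lipConst ((((L⁻¹ : ℝ≥0) : ℝ) • f : lipB X) : X →ᵇ ℝ) ≤ 1 := by
    refine lipConst_le fun x y => ?_
    change edist (((L⁻¹ : ℝ≥0) : ℝ) * (f : X →ᵇ ℝ) x) (((L⁻¹ : ℝ≥0) : ℝ) * (f : X →ᵇ ℝ) y) ≤ _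
    rw [hs, one_mul]
    calc (L⁻¹ : ℝ≥0) * edist ((f : X →ᵇ ℝ) x) ((f : X →ᵇ ℝ) y)
        ≤ (L⁻¹ : ℝ≥0) * (L * edist x y) := by gcongr; exact hL x y
      _ = edist x y := by
          rw [← mul_assoc, ← ENNReal.coe_mul, inv_mul_cancel₀ hL0, ENNReal.coe_one, one_mul]
  have h2 := edist_eval_le h1 φ ψ
  rw [eval_smul, eval_smul, hs] at h2
  calc edist (φ.eval f) (ψ.eval f)
      = L * ((L⁻¹ : ℝ≥0) * edist (φ.eval f) (ψ.eval f)) := by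
        rw [← mul_assoc, ← ENNReal.coe_mul, mul_inv_cancel₀ hL0, ENNReal.coe_one, one_mul]
    _ ≤ L * edist φ ψ := by gcongr

/-! ### Semicontinuity and measurability of the asymptotic slope. -/

theorem lipOn_le_lipConst {X : Type*} [EDist X] (f : X → ℝ) (A : Set X) :
    lipOn f A ≤ lipConst f := by
  refine iSup₂_le fun x _ => iSup₂_le fun y _ => ?_
  exact le_iSup₂_of_le x (Set.mem_univ _) (le_iSup₂_of_le y (Set.mem_univ _) le_rfl)

theorem slope_nonneg (f : lipB X) (x : X) : 0 ≤ slope f x := ENNReal.toReal_nonneg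

theorem slope_aux_ne_top (f : lipB X) (x : X) :
    (⨅ U : Set X, ⨅ _ : IsOpen U, ⨅ _ : x ∈ U, lipOn (f : X →ᵇ ℝ) U) ≠ ∞ := by
  refine ne_top_of_le_ne_top (lipConst_lt_top f).ne ?_
  exact iInf_le_of_le Set.univ (iInf₂_le_of_le isOpen_univ (Set.mem_univ x) le_rfl)

theorem slope_lt_iff (f : lipB X) (x : X) {c : ℝ≥0} :
    slope f x < c ↔ ∃ U : Set X, IsOpen U ∧ x ∈ U ∧ lipOn (f : X →ᵇ ℝ) U < c := by
  rw [slope, ← ENNReal.coe_toReal c, ENNReal.toReal_lt_toReal (slope_aux_ne_top f x)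
    ENNReal.coe_ne_top]
  simp only [iInf_lt_iff, exists_prop]

theorem slope_le_lipOn (f : lipB X) {U : Set X} (hU : IsOpen U) {x : X} (hx : x ∈ U) :
    slope f x ≤ (lipOn (f : X →ᵇ ℝ) U).toReal := by
  refine ENNReal.toReal_mono
    (ne_top_of_le_ne_top (lipConst_lt_top f).ne (lipOn_le_lipConst _ _)) ?_
  exact iInf_le_of_le U (iInf₂_le_of_le hU hx le_rfl)

/-- A neighbourhood witnessing the strict inequality at one point witnesses it at all of its points.
-/
theorem isOpen_slope_lt (f : lipB X) (c : ℝ≥0) : IsOpen {x | slope f x < c} := by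
  rw [isOpen_iff_forall_mem_open]
  intro x hx
  obtain ⟨U, hU, hxU, hlt⟩ := (slope_lt_iff f x).1 hx
  exact ⟨U, fun y hy => (slope_lt_iff f y).2 ⟨U, hU, hy, hlt⟩, hU, hxU⟩

theorem upperSemicontinuous_slope (f : lipB X) : UpperSemicontinuous (slope f) := by
  rw [upperSemicontinuous_iff_isOpen_preimage]
  intro c
  rcases le_or_gt c 0 with hc | hc
  · convert isOpen_empty
    ext x
    simp only [Set.mem_preimage, Set.mem_Iio, Set.mem_empty_iff_false, iff_false, not_lt]
    exact hc.trans (slope_nonneg f x)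
  · exact isOpen_slope_lt f ⟨c, hc.le⟩

theorem measurable_slope [MeasurableSpace X] [BorelSpace X] (f : lipB X) :
    Measurable (slope f) := (upperSemicontinuous_slope f).measurable

/-! ### The isomorphism between `Lip_b(X̂)` and `Lip_b(X)`. -/

section

variable [EMTSpace X]

theorem pullLip_gelfand (f : lipB X) : pullLip (gelfand f) = f := rfl

theorem pullLip_apply (F : lipB (Compactification X)) (x : X) :
    (pullLip F : X →ᵇ ℝ) x = (F : Compactification X →ᵇ ℝ) (emb x) := rfl

theorem pullLip_injective : Function.Injective (pullLip : lipB (Compactification X) →ₐ[ℝ] lipB X) :=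
    fun F G h => by
  refine Subtype.ext (DFunLike.ext' ?_)
  refine denseRange_emb.equalizer (F : Compactification X →ᵇ ℝ).continuous
    (G : Compactification X →ᵇ ℝ).continuous (funext fun x => ?_)
  change (F : Compactification X →ᵇ ℝ) (emb x) = (G : Compactification X →ᵇ ℝ) (emb x)
  rw [← pullLip_apply, h, pullLip_apply]

theorem pullLip_surjective :
    Function.Surjective (pullLip : lipB (Compactification X) →ₐ[ℝ] lipB X) :=
  fun f => ⟨gelfand f, pullLip_gelfand f⟩

theorem gelfand_pullLip (F : lipB (Compactification X)) : gelfand (pullLip F) = F :=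
  pullLip_injective (pullLip_gelfand _)

theorem lipOn_preimage_emb_le (F : lipB (Compactification X)) (U : Set (Compactification X)) :
    lipOn (pullLip F : X →ᵇ ℝ) (emb ⁻¹' U) ≤ lipOn (F : Compactification X →ᵇ ℝ) U := by
  refine iSup₂_le fun x hx => iSup₂_le fun y hy => iSup_le fun hne => ?_
  refine le_iSup₂_of_le (emb x) hx (le_iSup₂_of_le (emb y) hy
    (le_iSup_of_le (emb_injective.ne hne) ?_))
  rw [edist_emb]
  rfl

theorem lipConst_pullLip (F : lipB (Compactification X)) :
    lipConst (pullLip F : X →ᵇ ℝ) = lipConst (F : Compactification X →ᵇ ℝ) := by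
  refine le_antisymm (lipOn_preimage_emb_le F Set.univ) ?_
  -- Passing to a strictly larger `L` keeps it nonzero even when the Lipschitz constant vanishes.
  refine le_of_forall_gt fun c hc => ?_
  obtain ⟨L, hL, hLc⟩ := ENNReal.lt_iff_exists_nnreal_btwn.1 hc
  refine lt_of_le_of_lt (lipConst_le fun φ ψ => ?_) hLc
  have hL0 : L ≠ 0 := by
    rintro rfl
    exact absurd hL (by simp)
  rw [← gelfand_pullLip F]
  exact Compactification.edist_eval_le_mul hL0
    (fun x y => edist_le_of_lipOn_le hL0 hL.le (Set.mem_univ x) (Set.mem_univ y)) φ ψ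

theorem norm_pullLip (F : lipB (Compactification X)) :
    ‖(pullLip F : X →ᵇ ℝ)‖ = ‖(F : Compactification X →ᵇ ℝ)‖ := by
  refine le_antisymm ?_ ?_
  · exact (BoundedContinuousFunction.norm_le (norm_nonneg _)).2 fun x =>
      (F : Compactification X →ᵇ ℝ).norm_coe_le_norm (emb x)
  · refine (BoundedContinuousFunction.norm_le (norm_nonneg _)).2 fun φ => ?_
    conv_lhs => rw [← gelfand_pullLip F]
    exact φ.abs_eval_le (pullLip F)

theorem lipNorm_pullLip (F : lipB (Compactification X)) : lipNorm (pullLip F) = lipNorm F := by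
  rw [lipNorm, lipNorm, lipConst_pullLip, norm_pullLip]

/-- Only the open sets `ι⁻¹(U)` are compared, and `U` may contain pairs of points outside `ι(X)`;
hence an inequality. -/
theorem slope_pullLip_le (F : lipB (Compactification X)) (x : X) :
    slope (pullLip F) x ≤ slope F (emb x) := by
  refine ENNReal.toReal_mono (slope_aux_ne_top F _) ?_
  refine le_iInf fun U => le_iInf₂ fun hU hx => ?_
  exact iInf_le_of_le (emb ⁻¹' U) (iInf₂_le_of_le (hU.preimage continuous_emb) hx
    (lipOn_preimage_emb_le F U))

end

end Embedding

/-! ### Order structure of `L⁰(m)` -/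

section Infimum

variable {X : Type*} [MeasurableSpace X] {m : Measure X}

theorem integrable_arctan [IsFiniteMeasure m] (u : X →ₘ[m] ℝ) :
    Integrable (fun x => Real.arctan (u x)) m :=
  Integrable.of_bound (Real.continuous_arctan.comp_aestronglyMeasurable u.aestronglyMeasurable)
    (Real.pi / 2) (Eventually.of_forall fun _ => abs_le.2
      ⟨(Real.neg_pi_div_two_lt_arctan _).le, (Real.arctan_lt_pi_div_two _).le⟩)

/-- Nonempty sets in `L⁰(m)` that are bounded below and closed under binary infima have an
infimum. -/
theorem exists_isGLB_of_infClosed [IsFiniteMeasure m] {S : Set (X →ₘ[m] ℝ)} (hS : InfClosed S)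
    (hne : S.Nonempty) {l : X →ₘ[m] ℝ} (hl : l ∈ lowerBounds S) : ∃ g, IsGLB S g := by
  -- The bounded, strictly increasing `arctan` makes every class integrable, so `J` is finite and
  -- strictly monotone. The infimum is built from a minimising sequence of `J`.
  set J : (X →ₘ[m] ℝ) → ℝ := fun u => ∫ x, Real.arctan (u x) ∂m
  have hJmono : ∀ {u v}, u ≤ v → J u ≤ J v := fun {u v} huv =>
    integral_mono_ae (integrable_arctan u) (integrable_arctan v) <| by
      filter_upwards [AEEqFun.coeFn_le.2 huv] with x hx
      exact Real.arctan_strictMono.monotone hx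
  have hbdd : BddBelow (J '' S) := ⟨J l, by
    rintro _ ⟨u, hu, rfl⟩
    exact hJmono (hl hu)⟩
  have hex : ∀ n : ℕ, ∃ u ∈ S, J u < sInf (J '' S) + 1 / ((n : ℝ) + 1) := fun n => by
    obtain ⟨_, ⟨u, hu, rfl⟩, h⟩ := exists_lt_of_csInf_lt (hne.image J)
      (lt_add_of_pos_right (sInf (J '' S)) (Nat.one_div_pos_of_nat (α := ℝ) (n := n)))
    exact ⟨u, hu, h⟩
  choose u huS hu using hex
  have hmeas : Measurable fun x => ⨅ n, u n x := Measurable.iInf fun n => (u n).measurable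
  set g : X →ₘ[m] ℝ := AEEqFun.mk _ hmeas.aestronglyMeasurable
  have hg : ∀ᵐ x ∂m, g x = ⨅ n, u n x := AEEqFun.coeFn_mk _ _
  have hlu : ∀ᵐ x ∂m, ∀ n, l x ≤ u n x :=
    ae_all_iff.2 fun n => AEEqFun.coeFn_le.2 (hl (huS n))
  have hgu : ∀ n, g ≤ u n := fun n => AEEqFun.coeFn_le.1 <| by
    filter_upwards [hg, hlu] with x h1 h2
    rw [h1]
    exact ciInf_le ⟨l x, by rintro _ ⟨k, rfl⟩; exact h2 k⟩ n
  refine ⟨g, fun v hv => ?_, fun w hw => ?_⟩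
  -- The map `a ↦ arctan a - arctan (a ⊓ v)` is increasing, so the loss from `g` to `g ⊓ v` is at
  -- most that from `u n` to `u n ⊓ v`. The latter element lies in `S`, so this loss is below `1 /
  -- (n + 1)`.
  · have hle : ∀ n : ℕ, J g - J (g ⊓ v) ≤ 1 / ((n : ℝ) + 1) := fun n => by
      have h1 : sInf (J '' S) ≤ J (u n ⊓ v) :=
        csInf_le hbdd ⟨_, hS (huS n) hv, rfl⟩
      have h2 : J g - J (g ⊓ v) ≤ J (u n) - J (u n ⊓ v) := by
        simp only [J]
        rw [← integral_sub (integrable_arctan _) (integrable_arctan _),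
          ← integral_sub (integrable_arctan _) (integrable_arctan _)]
        refine integral_mono_ae ((integrable_arctan _).sub (integrable_arctan _))
          ((integrable_arctan _).sub (integrable_arctan _)) ?_
        filter_upwards [AEEqFun.coeFn_le.2 (hgu n), AEEqFun.coeFn_inf g v,
          AEEqFun.coeFn_inf (u n) v] with x h3 h4 h5
        simp only [h4, h5]
        have ha := Real.arctan_strictMono.monotone h3
        rcases le_total (g x) (v x) with h6 | h6
        · rw [inf_of_le_left h6, sub_self, sub_nonneg]
          exact Real.arctan_strictMono.monotone inf_le_left
        · rw [inf_of_le_right h6, inf_of_le_right (h6.trans h3)]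
          linarith
      linarith [hu n]
    have h0 : J g - J (g ⊓ v) ≤ 0 :=
      ge_of_tendsto' tendsto_one_div_add_atTop_nhds_zero_nat hle
    have hnn : 0 ≤ᵐ[m] fun x => Real.arctan (g x) - Real.arctan ((g ⊓ v : X →ₘ[m] ℝ) x) := by
      filter_upwards [AEEqFun.coeFn_le.2 (inf_le_left : g ⊓ v ≤ g)] with x hx
      exact sub_nonneg.2 (Real.arctan_strictMono.monotone hx)
    have hint := (integrable_arctan g).sub (integrable_arctan (g ⊓ v))
    have hz : ∫ x, (Real.arctan (g x) - Real.arctan ((g ⊓ v : X →ₘ[m] ℝ) x)) ∂m = 0 := by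
      refine le_antisymm ?_ (integral_nonneg_of_ae hnn)
      rw [integral_sub (integrable_arctan _) (integrable_arctan _)]
      exact h0
    -- Equality of the two integrals, with injectivity of `arctan`, forces `g = g ⊓ v` a.e.
    refine AEEqFun.coeFn_le.1 ?_
    filter_upwards [(integral_eq_zero_iff_of_nonneg_ae hnn hint).1 hz,
      AEEqFun.coeFn_inf g v] with x h1 h2
    have h3 : g x = g x ⊓ v x := by
      rw [← h2]
      exact Real.arctan_injective (sub_eq_zero.1 h1)
    exact h3.le.trans inf_le_right
  · refine AEEqFun.coeFn_le.1 ?_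
    filter_upwards [hg, ae_all_iff.2 fun n => AEEqFun.coeFn_le.2 (hw (huS n))] with x h1 h2
    rw [h1]
    exact le_ciInf h2

theorem isGLB_infL0 {S : Set (X →ₘ[m] ℝ)} (h : ∃ g, IsGLB S g) : IsGLB S (infL0 S) := by
  rw [infL0, dif_pos h]
  exact h.choose_spec

end Infimum

/-! ### Existence of the Weaver and Di Marino norms. -/

section Norms

variable {X : Type*} [TopologicalSpace X] [EDist X] [MeasurableSpace X] [BorelSpace X]
  {m : Measure X}

theorem infClosed_weaverBounds (b : Der m) : InfClosed (weaverBounds b) := by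
  rintro g ⟨hg0, hgm, hg⟩ h ⟨hh0, hhm, hh⟩
  refine ⟨le_inf hg0 hh0, ?_, fun f => ?_⟩
  · exact (hgm.inf hhm).ae_eq (AEEqFun.coeFn_inf g h).symm
  · filter_upwards [hg f, hh f, AEEqFun.coeFn_inf g h] with x h1 h2 h3
    rw [h3]
    rcases le_total (g x) (h x) with h4 | h4
    · rwa [inf_of_le_left h4]
    · rwa [inf_of_le_right h4]

theorem infClosed_diMarinoBounds (b : Der m) : InfClosed (diMarinoBounds b) := by
  rintro g ⟨hg0, hg⟩ h ⟨hh0, hh⟩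
  refine ⟨le_inf hg0 hh0, fun f => ?_⟩
  filter_upwards [hg f, hh f, AEEqFun.coeFn_inf g h] with x h1 h2 h3
  rw [h3]
  rcases le_total (g x) (h x) with h4 | h4
  · rwa [inf_of_le_left h4]
  · rwa [inf_of_le_right h4]

theorem isGLB_weaverNorm [IsFiniteMeasure m] {b : Der m} (h : (weaverBounds b).Nonempty) :
    IsGLB (weaverBounds b) (weaverNorm b) :=
  isGLB_infL0 (exists_isGLB_of_infClosed (infClosed_weaverBounds b) h fun _ hg => hg.1)

theorem isGLB_diMarinoNorm [IsFiniteMeasure m] {b : Der m} (h : b ∈ der0 m) :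
    IsGLB (diMarinoBounds b) (diMarinoNorm b) :=
  isGLB_infL0 (exists_isGLB_of_infClosed (infClosed_diMarinoBounds b) h fun _ hg => hg.1)

end Norms

/-! ### Transfer between `L⁰(m)` and `L⁰(m̂)` -/

section Transfer

variable {X : Type*} [TopologicalSpace X] [EDist X] [MeasurableSpace X] [BorelSpace X]
  {m : Measure X}

theorem coeFn_pullL0 (u : Compactification X →ₘ[hatMeasure m] ℝ) :
    ∀ᵐ x ∂m, pullL0 u x = u (emb x) :=
  AEEqFun.coeFn_compMeasurePreserving u (measurePreserving_emb m)

theorem ae_hatMeasure_iff {p : Compactification X → Prop} (hp : MeasurableSet {φ | p φ}) :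
    (∀ᵐ φ ∂hatMeasure m, p φ) ↔ ∀ᵐ x ∂m, p (emb x) :=
  ae_map_iff continuous_emb.aemeasurable hp

theorem pullL0_le_pullL0_iff {u v : Compactification X →ₘ[hatMeasure m] ℝ} :
    pullL0 u ≤ pullL0 v ↔ u ≤ v := by
  rw [← AEEqFun.coeFn_le, ← AEEqFun.coeFn_le (f := u)]
  refine Iff.trans ?_ (ae_hatMeasure_iff (measurableSet_le u.measurable v.measurable)).symm
  refine eventually_congr ?_
  filter_upwards [coeFn_pullL0 u, coeFn_pullL0 v] with x h1 h2
  rw [h1, h2]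

theorem memLp_pullL0_iff {u : Compactification X →ₘ[hatMeasure m] ℝ} {q : ℝ≥0∞} :
    MemLp (pullL0 u) q m ↔ MemLp u q (hatMeasure m) := by
  rw [memLp_congr_ae (coeFn_pullL0 u)]
  exact (memLp_map_measure_iff u.aestronglyMeasurable continuous_emb.aemeasurable).symm

theorem integrable_pullL0_iff {u : Compactification X →ₘ[hatMeasure m] ℝ} :
    Integrable (pullL0 u) m ↔ Integrable u (hatMeasure m) := by
  rw [← memLp_one_iff_integrable, ← memLp_one_iff_integrable, memLp_pullL0_iff]

theorem integral_hatMeasure {u : Compactification X → ℝ}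
    (hu : AEStronglyMeasurable u (hatMeasure m)) :
    ∫ φ, u φ ∂hatMeasure m = ∫ x, u (emb x) ∂m :=
  integral_map continuous_emb.aemeasurable hu

theorem integral_pullL0 (u : Compactification X →ₘ[hatMeasure m] ℝ) :
    ∫ x, pullL0 u x ∂m = ∫ φ, u φ ∂hatMeasure m := by
  rw [integral_hatMeasure u.aestronglyMeasurable]
  exact integral_congr_ae (coeFn_pullL0 u)

variable [EMTSpace X] [IsFiniteMeasure m] [m.InnerRegular]

theorem pullL0_pushDer (b : Der m) (F : lipB (Compactification X)) :
    pullL0 (pushDer b F) = b (pullLip F) := by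
  rw [pushDer_apply, pullL0_pushL0]

theorem pushL0_le_iff {u : X →ₘ[m] ℝ} {v : Compactification X →ₘ[hatMeasure m] ℝ} :
    pushL0 u ≤ v ↔ u ≤ pullL0 v := by
  rw [← pullL0_le_pullL0_iff, pullL0_pushL0]

theorem le_pushL0_iff {u : X →ₘ[m] ℝ} {v : Compactification X →ₘ[hatMeasure m] ℝ} :
    v ≤ pushL0 u ↔ pullL0 v ≤ u := by
  rw [← pullL0_le_pullL0_iff, pullL0_pushL0]

theorem pushDer_injective : Function.Injective (pushDer : Der m → Der (hatMeasure m)) := by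
  intro b c h
  ext1 f
  rw [← pullLip_gelfand f, ← pullL0_pushDer, h, pullL0_pushDer]

/-- Conjugation by the Gelfand transform, the inverse of `pullLip`, produces the preimage. -/
theorem pushDer_surjective : Function.Surjective (pushDer : Der m → Der (hatMeasure m)) := by
  intro c
  have hadd : ∀ f g : lipB X, gelfand (f + g) = gelfand f + gelfand g := fun f g =>
    pullLip_injective (by rw [map_add]; rfl)
  have hsmul : ∀ (r : ℝ) (f : lipB X), gelfand (r • f) = r • gelfand f := fun r f =>
    pullLip_injective (by rw [map_smul]; rfl)
  have hmul : ∀ f g : lipB X, gelfand (f * g) = gelfand f * gelfand g := fun f g =>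
    pullLip_injective (by rw [map_mul]; rfl)
  have e : ∀ f : lipB X, pullL0 (m := m) (lipToL0 (gelfand f)) = lipToL0 f := fun _ => rfl
  refine ⟨Derivation.mk'
    { toFun := fun f => pullL0 (c (gelfand f))
      map_add' := fun f g => by rw [hadd, map_add, map_add]
      map_smul' := fun r f => by
        rw [hsmul, Derivation.map_smul, pullL0_smul, RingHom.id_apply] }
    fun f g => ?_, ?_⟩
  · simp only [LinearMap.coe_mk, AddHom.coe_mk, hmul, Derivation.leibniz, lip_smul_def, map_add,
      map_mul, e]
  · ext1 F
    refine pullL0_injective ?_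
    rw [pullL0_pushDer]
    change pullL0 (c (gelfand (pullLip F))) = _
    rw [gelfand_pullLip]

theorem isLinearMap_pushDer : IsLinearMap ℝ (pushDer : Der m → Der (hatMeasure m)) where
  map_add b c := by
    ext1 F
    refine pullL0_injective ?_
    rw [pullL0_pushDer, Derivation.add_apply, Derivation.add_apply, map_add, pullL0_pushDer,
      pullL0_pushDer]
  map_smul r b := by
    ext1 F
    refine pullL0_injective ?_
    rw [pullL0_pushDer, Derivation.smul_apply, Derivation.smul_apply, pullL0_smul,
      pullL0_pushDer]

theorem pushDer_smul (h : X →ₘ[m] ℝ) (b : Der m) :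
    pushDer (h • b) = pushL0 h • pushDer b := by
  ext1 F
  refine pullL0_injective ?_
  rw [pullL0_pushDer, Derivation.smul_apply, Derivation.smul_apply, smul_eq_mul, smul_eq_mul,
    map_mul, pullL0_pushL0, pullL0_pushDer]

/-! ### Divergence, locality and bounds under push-forward -/

theorem isDivergence_pushDer_iff {b : Der m} {v : Compactification X →ₘ[hatMeasure m] ℝ} :
    IsDivergence (pushDer b) v ↔ IsDivergence b (pullL0 v) := by
  have h3 : ∀ F : lipB (Compactification X),
      ∫ φ, (F : Compactification X →ᵇ ℝ) φ * v φ ∂hatMeasure m =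
        ∫ x, (pullLip F : X →ᵇ ℝ) x * pullL0 v x ∂m := fun F => by
    rw [integral_hatMeasure (u := fun φ => (F : Compactification X →ᵇ ℝ) φ * v φ)
      ((F : Compactification X →ᵇ ℝ).continuous.aestronglyMeasurable.mul
      v.aestronglyMeasurable)]
    refine integral_congr_ae ?_
    filter_upwards [coeFn_pullL0 v] with x hx
    rw [hx, pullLip_apply]
  refine and_congr ?_ (and_congr integrable_pullL0_iff.symm ?_)
  · rw [(pullLip_surjective (X := X)).forall]
    refine forall_congr' fun F => ?_
    rw [← integrable_pullL0_iff, pullL0_pushDer]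
  · rw [(pullLip_surjective (X := X)).forall]
    refine forall_congr' fun F => ?_
    rw [h3, ← integral_pullL0, pullL0_pushDer]

theorem pushDer_mem_divDomain_iff {b : Der m} :
    pushDer b ∈ divDomain (hatMeasure m) ↔ b ∈ divDomain m := by
  constructor
  · rintro ⟨v, hv⟩
    exact ⟨_, isDivergence_pushDer_iff.1 hv⟩
  · rintro ⟨v, hv⟩
    exact ⟨pushL0 v, isDivergence_pushDer_iff.2 (by rwa [pullL0_pushL0])⟩

theorem isLocal_pushDer_iff {b : Der m} : IsLocal (pushDer b) ↔ IsLocal b := by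
  rw [IsLocal, IsLocal, (pullLip_surjective (X := X)).forall]
  refine forall_congr' fun F => ?_
  rw [ae_hatMeasure_iff]
  · refine eventually_congr ?_
    filter_upwards [coeFn_pullL0 (pushDer b F)] with x hx
    rw [← hx, pullL0_pushDer, pullLip_apply]
  · have h1 : MeasurableSet {φ | (F : Compactification X →ᵇ ℝ) φ = 0} :=
      (isClosed_singleton.preimage (F : Compactification X →ᵇ ℝ).continuous).measurableSet
    have h2 : MeasurableSet {φ | pushDer b F φ = 0} :=
      (pushDer b F).measurable (measurableSet_singleton 0)
    exact h1.imp h2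

theorem pushDer_bound_iff (b : Der m) (F : lipB (Compactification X))
    (g : Compactification X →ₘ[hatMeasure m] ℝ) {s : Compactification X → ℝ}
    (hs : Measurable s) : (∀ᵐ φ ∂hatMeasure m, |pushDer b F φ| ≤ g φ * s φ) ↔
      ∀ᵐ x ∂m, |b (pullLip F) x| ≤ pullL0 g x * s (emb x) := by
  rw [ae_hatMeasure_iff (p := fun φ => |pushDer b F φ| ≤ g φ * s φ)
    (measurableSet_le (pushDer b F).measurable.abs (g.measurable.mul hs))]
  refine eventually_congr ?_
  filter_upwards [coeFn_pullL0 (pushDer b F), coeFn_pullL0 g] with x h1 h2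
  rw [← h1, pullL0_pushDer, h2]

/-- `pullLip` preserves `lipNorm`, so the bounds correspond in both directions. -/
theorem mem_weaverBounds_pushDer_iff {b : Der m} {g : Compactification X →ₘ[hatMeasure m] ℝ} :
    g ∈ weaverBounds (pushDer b) ↔ pullL0 g ∈ weaverBounds b := by
  refine and_congr ?_ (and_congr memLp_pullL0_iff.symm ?_)
  · rw [← pullL0_le_pullL0_iff, map_zero]
  · rw [(pullLip_surjective (X := X)).forall]
    refine forall_congr' fun F => ?_
    rw [pushDer_bound_iff b F g measurable_const, lipNorm_pullLip]

/-- One implication only: slopes can only grow on passing to the compactification. -/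
theorem mem_diMarinoBounds_pushDer_of_pullL0 {b : Der m}
    {g : Compactification X →ₘ[hatMeasure m] ℝ} (h : pullL0 g ∈ diMarinoBounds b) :
    g ∈ diMarinoBounds (pushDer b) := by
  obtain ⟨h0, hb⟩ := h
  refine ⟨?_, fun F => ?_⟩
  · rwa [← pullL0_le_pullL0_iff, map_zero]
  · rw [pushDer_bound_iff b F g (measurable_slope F)]
    filter_upwards [hb (pullLip F), AEEqFun.coeFn_le.2 h0, AEEqFun.coeFn_zero (β := ℝ) (μ := m)]
      with x h1 h2 h3
    rw [h3] at h2
    exact h1.trans (mul_le_mul_of_nonneg_left (slope_pullLip_le F x) h2)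

theorem pushDer_mem_weaver {b : Der m} (hb : b ∈ weaver m) :
    pushDer b ∈ weaver (hatMeasure m) := by
  obtain ⟨h1, h2⟩ := hb
  refine ⟨fun F => ?_, fun F f hF hf hlim h hh => ?_⟩
  · rw [← memLp_pullL0_iff, pullL0_pushDer]
    exact h1 _
  · have key : ∀ G : lipB (Compactification X), ∫ φ, h φ * pushDer b G φ ∂hatMeasure m =
        ∫ x, h (emb x) * b (pullLip G) x ∂m := fun G => by
      rw [integral_hatMeasure (u := fun φ => h φ * pushDer b G φ)
        (hh.aestronglyMeasurable.mul (pushDer b G).aestronglyMeasurable)]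
      refine integral_congr_ae ?_
      filter_upwards [coeFn_pullL0 (pushDer b G)] with x hx
      rw [← hx, pullL0_pushDer]
    simp only [key]
    exact h2 (fun n => pullLip (F n)) (pullLip f) (fun n => by rw [lipNorm_pullLip]; exact hF n)
      (by rwa [lipNorm_pullLip]) (fun x => hlim (emb x)) (fun x => h (emb x))
      (hh.comp_measurable continuous_emb.measurable)

end Transfer

/-! ### Approximation of functions on compact sets -/

section Approximation

/-- A lattice form of the Stone-Weierstrass theorem: approximability at pairs of points of a
compact set gives uniform approximability. -/
theorem exists_forall_abs_sub_lt_of_lattice {X : Type*} [TopologicalSpace X] {S : Set (X →ᵇ ℝ)}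
    (hsup : SupClosed S) (hinf : InfClosed S) (hne : S.Nonempty) {K : Set X} (hK : IsCompact K)
    {f : X → ℝ} (hf : ContinuousOn f K) {ε : ℝ}
    (h : ∀ x ∈ K, ∀ y ∈ K, ∃ u ∈ S, f x - ε < u x ∧ u y < f y + ε) :
    ∃ w ∈ S, ∀ z ∈ K, |w z - f z| < ε := by
  -- With `x` fixed, finitely many minima over `y` push the function below `f + ε` on `K`. Maxima
  -- over `x` then lift it above `f - ε`.
  have h1 : ∀ x ∈ K, ∃ v ∈ S, f x - ε < v x ∧ ∀ z ∈ K, v z < f z + ε := by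
    intro x hx
    have : ∃ v ∈ S, f x - ε < v x ∧ ∀ z ∈ K, z ∈ K → v z < f z + ε := by
      refine hK.induction_on
        (p := fun s => ∃ v ∈ S, f x - ε < v x ∧ ∀ z ∈ s, z ∈ K → v z < f z + ε) ?_ ?_ ?_ ?_
      · obtain ⟨u, hu, hux, -⟩ := h x hx x hx
        exact ⟨u, hu, hux, by simp⟩
      · rintro s t hst ⟨v, hv, hvx, hvt⟩
        exact ⟨v, hv, hvx, fun z hz => hvt z (hst hz)⟩
      · rintro s t ⟨v, hv, hvx, hvs⟩ ⟨w, hw, hwx, hwt⟩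
        refine ⟨v ⊓ w, hinf hv hw, lt_inf_iff.2 ⟨hvx, hwx⟩, ?_⟩
        rintro z (hz | hz) hzK
        · exact inf_le_left.trans_lt (hvs z hz hzK)
        · exact inf_le_right.trans_lt (hwt z hz hzK)
      · intro y hy
        obtain ⟨u, hu, hux, huy⟩ := h x hx y hy
        exact ⟨{z | u z < f z + ε}, (u.continuous.continuousOn y hy).eventually_lt
          ((hf y hy).add continuousWithinAt_const) huy, u, hu, hux, fun z hz _ => hz⟩
    obtain ⟨v, hv, hvx, hvK⟩ := this
    exact ⟨v, hv, hvx, fun z hz => hvK z hz hz⟩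
  have h2 : ∃ w ∈ S, (∀ z ∈ K, w z < f z + ε) ∧ ∀ z ∈ K, f z - ε < w z := by
    rcases K.eq_empty_or_nonempty with rfl | ⟨x0, hx0⟩
    · obtain ⟨w, hw⟩ := hne
      exact ⟨w, hw, by simp, by simp⟩
    refine hK.induction_on
      (p := fun s => ∃ w ∈ S, (∀ z ∈ K, w z < f z + ε) ∧ ∀ z ∈ s, f z - ε < w z) ?_ ?_ ?_ ?_
    · obtain ⟨v, hv, -, hvK⟩ := h1 x0 hx0
      exact ⟨v, hv, hvK, by simp⟩
    · rintro s t hst ⟨v, hv, hvK, hvt⟩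
      exact ⟨v, hv, hvK, fun z hz => hvt z (hst hz)⟩
    · rintro s t ⟨v, hv, hvK, hvs⟩ ⟨w, hw, hwK, hwt⟩
      refine ⟨v ⊔ w, hsup hv hw, fun z hz => sup_lt_iff.2 ⟨hvK z hz, hwK z hz⟩, ?_⟩
      rintro z (hz | hz)
      · exact (hvs z hz).trans_le le_sup_left
      · exact (hwt z hz).trans_le le_sup_right
    · intro x hx
      obtain ⟨v, hv, hvx, hvK⟩ := h1 x hx
      exact ⟨{z | f z - ε < v z}, ((hf x hx).sub continuousWithinAt_const).eventually_lt
        (v.continuous.continuousOn x hx) hvx, v, hv, hvK, fun z hz => hz⟩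
  obtain ⟨w, hw, hwK, hwK'⟩ := h2
  exact ⟨w, hw, fun z hz => abs_lt.2 ⟨by linarith [hwK' z hz], by linarith [hwK z hz]⟩⟩

theorem edist_max_max_le (a b c d : ℝ) :
    edist (max a b) (max c d) ≤ max (edist a c) (edist b d) := by
  simp only [edist_dist, Real.dist_eq]
  rw [← ENNReal.ofReal_max]
  exact ENNReal.ofReal_le_ofReal (abs_max_sub_max_le_max a b c d)

theorem edist_min_min_le (a b c d : ℝ) :
    edist (min a b) (min c d) ≤ max (edist a c) (edist b d) := by
  simp only [edist_dist, Real.dist_eq]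
  rw [← ENNReal.ofReal_max]
  exact ENNReal.ofReal_le_ofReal (abs_min_sub_min_le_max a b c d)

variable (X : Type*) [TopologicalSpace X] [EDist X]

/-- The bounded `τ`-continuous functions that are `d`-Lipschitz with constant `c`. -/
def lipBall (c : ℝ≥0) : Set (X →ᵇ ℝ) := {u | ∀ x y, edist (u x) (u y) ≤ c * edist x y}

variable {X}

theorem supClosed_lipBall (c : ℝ≥0) : SupClosed (lipBall X c) := fun _ hu _ hv x y =>
  (edist_max_max_le _ _ _ _).trans (max_le (hu x y) (hv x y))

theorem infClosed_lipBall (c : ℝ≥0) : InfClosed (lipBall X c) := fun _ hu _ hv x y =>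
  (edist_min_min_le _ _ _ _).trans (max_le (hu x y) (hv x y))

theorem lipBall_mono {c c' : ℝ≥0} (h : c ≤ c') : lipBall X c ⊆ lipBall X c' :=
  fun _ hu x y => (hu x y).trans (by gcongr)

theorem const_mem_lipBall (c : ℝ≥0) (r : ℝ) :
    BoundedContinuousFunction.const X r ∈ lipBall X c := fun x y => by simp

theorem add_mem_lipBall {c c' : ℝ≥0} {u v : X →ᵇ ℝ} (hu : u ∈ lipBall X c)
    (hv : v ∈ lipBall X c') : u + v ∈ lipBall X (c + c') := fun x y => by
  push_cast
  rw [add_mul]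
  exact (edist_add_add_le _ _ _ _).trans (add_le_add (hu x y) (hv x y))

theorem neg_mem_lipBall {c : ℝ≥0} {u : X →ᵇ ℝ} (hu : u ∈ lipBall X c) : -u ∈ lipBall X c :=
  fun x y => (edist_neg_neg (u x) (u y)).trans_le (hu x y)

theorem smul_mem_lipBall {c : ℝ≥0} {u : X →ᵇ ℝ} (hu : u ∈ lipBall X c) (r : ℝ≥0) :
    (r : ℝ) • u ∈ lipBall X (r * c) := fun x y => by
  have h := edist_smul₀ (r : ℝ) (u x) (u y)
  rw [Real.nnnorm_of_nonneg (NNReal.coe_nonneg r)] at h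
  refine h.trans_le ?_
  push_cast
  rw [mul_assoc]
  change (r : ℝ≥0∞) * _ ≤ _
  gcongr
  exact hu x y

theorem mem_lipB_of_mem_lipBall {c : ℝ≥0} {u : X →ᵇ ℝ} (hu : u ∈ lipBall X c) : u ∈ lipB X :=
  ⟨c, hu⟩

theorem supClosed_lipB : SupClosed (lipB X : Set (X →ᵇ ℝ)) := by
  rintro u ⟨c, hu⟩ v ⟨c', hv⟩
  exact ⟨c ⊔ c', supClosed_lipBall _ (lipBall_mono le_sup_left hu) (lipBall_mono le_sup_right hv)⟩

theorem infClosed_lipB : InfClosed (lipB X : Set (X →ᵇ ℝ)) := by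
  rintro u ⟨c, hu⟩ v ⟨c', hv⟩
  exact ⟨c ⊔ c', infClosed_lipBall _ (lipBall_mono le_sup_left hu) (lipBall_mono le_sup_right hv)⟩

/-- Truncation of a function at heights `ε` and `-ε`. -/
noncomputable def truncate (f : lipB X) (ε : ℝ) : lipB X :=
  ⟨((f : X →ᵇ ℝ) ⊓ BoundedContinuousFunction.const X ε) ⊔ BoundedContinuousFunction.const X (-ε),
    supClosed_lipB (infClosed_lipB f.2 ⟨0, const_mem_lipBall 0 ε⟩) ⟨0, const_mem_lipBall 0 (-ε)⟩⟩

theorem truncate_apply (f : lipB X) (ε : ℝ) (x : X) :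
    (truncate f ε : X →ᵇ ℝ) x = max (min ((f : X →ᵇ ℝ) x) ε) (-ε) := rfl

theorem truncate_mem_lipBall {f : lipB X} {c : ℝ≥0} (hf : (f : X →ᵇ ℝ) ∈ lipBall X c) (ε : ℝ) :
    (truncate f ε : X →ᵇ ℝ) ∈ lipBall X c :=
  supClosed_lipBall c (infClosed_lipBall c hf (const_mem_lipBall c ε)) (const_mem_lipBall c (-ε))

theorem abs_truncate_le (f : lipB X) {ε : ℝ} (hε : 0 ≤ ε) (x : X) :
    |(truncate f ε : X →ᵇ ℝ) x| ≤ ε := by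
  rw [truncate_apply, abs_le]
  exact ⟨le_max_right _ _, max_le (min_le_right _ _) (by linarith)⟩

theorem truncate_eq_of_abs_lt {f : lipB X} {ε : ℝ} {x : X} (h : |(f : X →ᵇ ℝ) x| < ε) :
    (truncate f ε : X →ᵇ ℝ) x = (f : X →ᵇ ℝ) x := by
  rw [abs_lt] at h
  rw [truncate_apply, min_eq_left h.2.le, max_eq_left h.1.le]

theorem integrable_lipB_mul [MeasurableSpace X] [BorelSpace X] {m : Measure X}
    (f : lipB X) {v : X → ℝ} (hv : Integrable v m) :
    Integrable (fun x => (f : X →ᵇ ℝ) x * v x) m :=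
  hv.bdd_mul (f : X →ᵇ ℝ).continuous.aestronglyMeasurable
    (Eventually.of_forall fun x => (f : X →ᵇ ℝ).norm_coe_le_norm x)

theorem abs_setIntegral_sub_integral_lipB_mul_le [MeasurableSpace X] [BorelSpace X]
    {m : Measure X} {E : Set X} (hE : MeasurableSet E) (h : lipB X) {v : X → ℝ}
    (hv : Integrable v m) : |∫ x in E, v x ∂m - ∫ x, (h : X →ᵇ ℝ) x * v x ∂m| ≤
      ∫ x, |E.indicator 1 x - (h : X →ᵇ ℝ) x| * |v x| ∂m := by
  rw [← integral_indicator hE, ← integral_sub (hv.indicator hE) (integrable_lipB_mul h hv)]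
  refine (abs_integral_le_integral_abs).trans_eq (integral_congr_ae (Eventually.of_forall ?_))
  intro x
  simp only
  rw [← abs_mul, sub_mul]
  congr 2
  by_cases hx : x ∈ E <;> simp [hx]

variable [EMTSpace X]

theorem exists_lipB_apply_ne {x y : X} (h : x ≠ y) :
    ∃ f : lipB X, (f : X →ᵇ ℝ) x ≠ (f : X →ᵇ ℝ) y := by
  by_contra! hf
  refine h (EMTSpace.eq_of_dist_eq_zero x y ?_)
  rw [EMTSpace.recovery]
  simp [hf]

/-- Two-point interpolation by an affine image of a separating function, as the lattice argument
requires. -/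
theorem exists_lipB_apply_eq (x y : X) {a b : ℝ} (h : x = y → a = b) :
    ∃ u ∈ lipB X, u x = a ∧ u y = b := by
  rcases eq_or_ne x y with rfl | hne
  · exact ⟨_, ⟨0, const_mem_lipBall 0 a⟩, rfl, h rfl⟩
  obtain ⟨f, hf⟩ := exists_lipB_apply_ne hne
  have hf' : (f : X →ᵇ ℝ) y - (f : X →ᵇ ℝ) x ≠ 0 := sub_ne_zero.2 hf.symm
  refine ⟨BoundedContinuousFunction.const X a + ((b - a) / ((f : X →ᵇ ℝ) y - (f : X →ᵇ ℝ) x)) •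
    ((f : X →ᵇ ℝ) - BoundedContinuousFunction.const X ((f : X →ᵇ ℝ) x)),
    add_mem ⟨0, const_mem_lipBall 0 a⟩ ((lipB X).smul_mem (sub_mem f.2 ⟨0, const_mem_lipBall 0 _⟩) _),
    ?_, ?_⟩
  · simp
  · simp [hf']

/-- Lipschitz functions separate disjoint compact sets. -/
theorem exists_lipB_abs_sub_indicator_lt {K C : Set X} (hK : IsCompact K) (hC : IsCompact C)
    (hKC : Disjoint K C) {ε : ℝ} (hε : 0 < ε) :
    ∃ h : lipB X, (∀ x, 0 ≤ (h : X →ᵇ ℝ) x ∧ (h : X →ᵇ ℝ) x ≤ 1) ∧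
      (∀ x ∈ K, |(h : X →ᵇ ℝ) x - 1| < ε) ∧ ∀ x ∈ C, |(h : X →ᵇ ℝ) x| < ε := by
  set f : X → ℝ := K.indicator 1
  have hfC : ∀ x ∈ C, f x = 0 := fun x hx =>
    Set.indicator_of_notMem (Set.disjoint_right.1 hKC hx) _
  have hfK : ∀ x ∈ K, f x = 1 := fun x hx => Set.indicator_of_mem hx _
  have hf : ContinuousOn f (K ∪ C) := by
    refine ContinuousOn.union_of_isClosed ?_ ?_ hK.isClosed hC.isClosed
    · exact continuousOn_const.congr hfK
    · exact continuousOn_const.congr hfC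
  obtain ⟨w, hw, hwf⟩ := exists_forall_abs_sub_lt_of_lattice supClosed_lipB infClosed_lipB
    ⟨1, one_mem (lipB X)⟩ (hK.union hC) hf (ε := ε) fun x _ y _ => by
      obtain ⟨u, hu, hux, huy⟩ := exists_lipB_apply_eq x y (congrArg f)
      exact ⟨u, hu, by rw [hux]; linarith, by rw [huy]; linarith⟩
  -- Clamping to `[0,1]` does not increase the distance to the values 0 and 1.
  refine ⟨⟨(w ⊔ BoundedContinuousFunction.const X 0) ⊓ BoundedContinuousFunction.const X 1,
    infClosed_lipB (supClosed_lipB hw ⟨0, const_mem_lipBall 0 0⟩) ⟨0, const_mem_lipBall 0 1⟩⟩,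
    fun x => ?_, fun x hx => ?_, fun x hx => ?_⟩
  · exact ⟨le_min (le_max_right _ _) zero_le_one, min_le_right _ _⟩
  · have h1 := hwf x (Or.inl hx)
    rw [hfK x hx] at h1
    change |min (max (w x) 0) 1 - 1| < ε
    rw [abs_lt] at h1 ⊢
    refine ⟨?_, by linarith [min_le_right (max (w x) 0) 1]⟩
    rw [lt_sub_iff_add_lt, lt_min_iff]
    exact ⟨lt_max_of_lt_left (by linarith), by linarith⟩
  · have h1 := hwf x (Or.inr hx)
    rw [hfC x hx, sub_zero] at h1
    change |min (max (w x) 0) 1| < ε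
    rw [abs_of_nonneg (le_min (le_max_right _ _) zero_le_one)]
    exact (min_le_left _ _).trans_lt (max_lt ((le_abs_self _).trans_lt h1) hε)

/-- A function that is `c`-Lipschitz on a compact set is a uniform limit there of globally
`c`-Lipschitz functions. -/
theorem exists_mem_lipBall_abs_sub_lt {K : Set X} (hK : IsCompact K) {f : X → ℝ}
    (hf : ContinuousOn f K) {c : ℝ≥0} (hc : c ≠ 0)
    (hlip : ∀ x ∈ K, ∀ y ∈ K, edist (f x) (f y) ≤ c * edist x y) {ε : ℝ} (hε : 0 < ε) :
    ∃ w ∈ lipBall X c, ∀ z ∈ K, |w z - f z| < ε := by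
  refine exists_forall_abs_sub_lt_of_lattice (supClosed_lipBall c) (infClosed_lipBall c)
    ⟨_, const_mem_lipBall c 0⟩ hK hf fun x hx y hy => ?_
  rcases lt_or_ge (f x - f y) ε with h | h
  · refine ⟨_, const_mem_lipBall c (f x), ?_, ?_⟩
    · rw [BoundedContinuousFunction.const_apply]; linarith
    · rw [BoundedContinuousFunction.const_apply]; linarith
  have hc' : (0 : ℝ) < c := NNReal.coe_pos.2 (pos_iff_ne_zero.2 hc)
  -- The slack `ε` makes the inequality strict, so the supremum recovering `d` contains a
  -- 1-Lipschitz function whose oscillation between `x` and `y`, times `c`, exceeds `f x - f y - ε`.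
  have h1 : ENNReal.ofReal ((f x - f y - ε) / c) < edist x y := by
    rw [ENNReal.ofReal_div_of_pos hc', ENNReal.ofReal_coe_nnreal]
    refine ENNReal.div_lt_of_lt_mul' (lt_of_lt_of_le ?_ (hlip x hx y hy))
    rw [edist_dist, Real.dist_eq]
    exact (ENNReal.ofReal_lt_ofReal_iff_of_nonneg (by linarith)).2
      (lt_of_lt_of_le (by linarith) (le_abs_self _))
  rw [EMTSpace.recovery] at h1
  simp only [lt_iSup_iff] at h1
  obtain ⟨v, hv, hlt⟩ := h1
  rw [edist_dist, Real.dist_eq, ENNReal.ofReal_lt_ofReal_iff_of_nonneg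
    (div_nonneg (by linarith) hc'.le), div_lt_iff₀ hc'] at hlt
  have hv1 : (v : X →ᵇ ℝ) ∈ lipBall X 1 := fun p q =>
    edist_le_of_lipOn_le one_ne_zero (by simpa [lipConst] using hv) (Set.mem_univ p)
      (Set.mem_univ q)
  -- A sign change removes the absolute value. The function `c s`, shifted to equal `f x` at `x`, is
  -- then below `f y + ε` at `y`.
  obtain ⟨s, hs, hsx⟩ : ∃ s ∈ lipBall X 1, f x - f y - ε < (s x - s y) * c := by
    rcases abs_cases ((v : X →ᵇ ℝ) x - (v : X →ᵇ ℝ) y) with h2 | h2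
    · exact ⟨v, hv1, by rwa [h2.1] at hlt⟩
    · refine ⟨-(v : X →ᵇ ℝ), neg_mem_lipBall hv1, ?_⟩
      rw [h2.1] at hlt
      simp only [BoundedContinuousFunction.coe_neg, Pi.neg_apply]
      linarith
  refine ⟨(c : ℝ) • s + BoundedContinuousFunction.const X (f x - c * s x), ?_, ?_, ?_⟩
  · have := add_mem_lipBall (smul_mem_lipBall hs c) (const_mem_lipBall 0 (f x - c * s x))
    rwa [mul_one, add_zero] at this
  · simp [hε]
  · simp only [BoundedContinuousFunction.coe_add, BoundedContinuousFunction.coe_smul,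
      Pi.add_apply, BoundedContinuousFunction.const_apply, smul_eq_mul]
    linarith

variable [MeasurableSpace X] [BorelSpace X] {m : Measure X} [IsFiniteMeasure m] [m.InnerRegular]

theorem exists_isCompact_measure_sdiff_lt {E : Set X} (hE : MeasurableSet E) {δ : ℝ≥0∞}
    (hδ : δ ≠ 0) : ∃ K ⊆ E, IsCompact K ∧ m (E \ K) < δ :=
  hE.exists_isCompact_sdiff_lt (measure_ne_top m E) hδ

/-- Lipschitz functions with values in `[0,1]` approximate indicators in weighted `L¹`. -/
theorem exists_lipB_integral_indicator_sub_lt {E : Set X} (hE : MeasurableSet E) {g : X → ℝ}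
    (hg : Integrable g m) {η : ℝ} (hη : 0 < η) :
    ∃ h : lipB X, (∀ x, 0 ≤ (h : X →ᵇ ℝ) x ∧ (h : X →ᵇ ℝ) x ≤ 1) ∧
      ∫ x, |E.indicator 1 x - (h : X →ᵇ ℝ) x| * |g x| ∂m < η := by
  set I := ∫ x, |g x| ∂m
  have hI : 0 ≤ I := integral_nonneg fun _ => abs_nonneg _
  obtain ⟨δ, hδ0, hδ⟩ : ∃ δ : ℝ≥0∞, 0 < δ ∧ ∀ s, m s < δ → ∫ x in s, |g x| ∂m < η / 2 := by
    obtain ⟨δ, hδ0, hδ⟩ := exists_pos_setLIntegral_lt_of_measure_lt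
      (hasFiniteIntegral_iff_enorm.1 hg.2).ne (ε := ENNReal.ofReal (η / 2))
      (by simpa using hη)
    refine ⟨δ, hδ0, fun s hs => ?_⟩
    have := hδ s hs
    rw [← ofReal_integral_norm_eq_lintegral_enorm hg.integrableOn] at this
    exact (ENNReal.ofReal_lt_ofReal_iff (by linarith)).1 this
  obtain ⟨K, hKE, hK, hmK⟩ := exists_isCompact_measure_sdiff_lt (m := m) hE
    (ENNReal.half_pos hδ0.ne').ne'
  obtain ⟨C, hCE, hC, hmC⟩ := exists_isCompact_measure_sdiff_lt (m := m) hE.compl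
    (ENNReal.half_pos hδ0.ne').ne'
  obtain ⟨h, h01, hhK, hhC⟩ := exists_lipB_abs_sub_indicator_lt hK hC
    (Set.disjoint_of_subset hKE hCE disjoint_compl_right) (ε := η / (2 * (I + 1)))
    (by positivity)
  refine ⟨h, h01, ?_⟩
  -- Off `B` the error is at most `η / (2 (I + 1))`; on `B` it is at most 1, and absolute continuity
  -- makes the integral of `|g|` small there.
  set B := (E \ K) ∪ (Eᶜ \ C)
  have hBm : MeasurableSet B := (hE.diff hK.measurableSet).union (hE.compl.diff hC.measurableSet)
  have hmB : m B < δ := (measure_union_le _ _).trans_lt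
    ((ENNReal.add_lt_add hmK hmC).trans_eq (ENNReal.add_halves δ))
  have hpt : ∀ x, |E.indicator 1 x - (h : X →ᵇ ℝ) x| * |g x| ≤
      η / (2 * (I + 1)) * |g x| + B.indicator (fun x => |g x|) x := by
    intro x
    by_cases hxB : x ∈ B
    · rw [Set.indicator_of_mem hxB]
      have h1 : |E.indicator 1 x - (h : X →ᵇ ℝ) x| ≤ 1 := by
        obtain ⟨ha, hb⟩ := h01 x
        by_cases hxE : x ∈ E
        · rw [Set.indicator_of_mem hxE, Pi.one_apply, abs_le]
          constructor <;> linarith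
        · rw [Set.indicator_of_notMem hxE, abs_le]
          constructor <;> linarith
      have h2 : 0 ≤ η / (2 * (I + 1)) * |g x| := by positivity
      have h3 := mul_le_mul_of_nonneg_right h1 (abs_nonneg (g x))
      linarith
    · rw [Set.indicator_of_notMem hxB, add_zero]
      refine mul_le_mul_of_nonneg_right ?_ (abs_nonneg _)
      by_cases hxE : x ∈ E
      · have hxK : x ∈ K := by
          by_contra hxK
          exact hxB (Or.inl ⟨hxE, hxK⟩)
        rw [Set.indicator_of_mem hxE, Pi.one_apply, abs_sub_comm]
        exact (hhK x hxK).le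
      · have hxC : x ∈ C := by
          by_contra hxC
          exact hxB (Or.inr ⟨hxE, hxC⟩)
        rw [Set.indicator_of_notMem hxE, zero_sub, abs_neg]
        exact (hhC x hxC).le
  have hi1 : Integrable (fun x => η / (2 * (I + 1)) * |g x|) m := hg.abs.const_mul _
  have hi2 : Integrable (B.indicator fun x => |g x|) m := hg.abs.indicator hBm
  calc ∫ x, |E.indicator 1 x - (h : X →ᵇ ℝ) x| * |g x| ∂m
      ≤ ∫ x, (η / (2 * (I + 1)) * |g x| + B.indicator (fun x => |g x|) x) ∂m :=
        integral_mono_of_nonneg (Eventually.of_forall fun x => by positivity) (hi1.add hi2)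
          (Eventually.of_forall hpt)
    _ = η / (2 * (I + 1)) * I + ∫ x in B, |g x| ∂m := by
        rw [integral_add hi1 hi2, integral_const_mul, integral_indicator hBm]
    _ < η / 2 + η / 2 := by
        refine add_lt_add_of_le_of_lt ?_ (hδ B hmB)
        rw [div_mul_eq_mul_div, div_le_div_iff₀ (by positivity) two_pos]
        nlinarith
    _ = η := add_halves η

/-- Approximating indicators by Lipschitz functions in the measure `|v| m` shows that every set
integral of `v` vanishes. -/
theorem ae_eq_zero_of_forall_integral_lipB_mul_eq_zero {v : X → ℝ} (hv : Integrable v m)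
    (h : ∀ f : lipB X, ∫ x, (f : X →ᵇ ℝ) x * v x ∂m = 0) : v =ᵐ[m] 0 := by
  refine hv.ae_eq_zero_of_forall_setIntegral_eq_zero fun E hE _ => ?_
  refine abs_nonpos_iff.1 (le_of_forall_pos_le_add fun η hη => ?_)
  obtain ⟨f, -, hf⟩ := exists_lipB_integral_indicator_sub_lt hE hv hη
  have := (abs_setIntegral_sub_integral_lipB_mul_le hE f hv).trans hf.le
  rwa [h, sub_zero, ← zero_add η] at this

end Approximation

/-! ### Uniqueness and push-forward of the divergence. -/

section Divergence

variable {X : Type*} [TopologicalSpace X] [EDist X] [MeasurableSpace X] [BorelSpace X]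
  {m : Measure X}

theorem isDivergence_divergence {b : Der m} (hb : b ∈ divDomain m) :
    IsDivergence b (divergence b) := by
  have h : ∃ v, IsDivergence b v := hb
  rw [divergence, dif_pos h]
  exact h.choose_spec

variable [EMTSpace X] [IsFiniteMeasure m] [m.InnerRegular]

theorem IsDivergence.unique {b : Der m} {v w : X →ₘ[m] ℝ} (hv : IsDivergence b v)
    (hw : IsDivergence b w) : v = w := by
  refine AEEqFun.ext ?_
  have h := ae_eq_zero_of_forall_integral_lipB_mul_eq_zero (hv.2.1.sub hw.2.1) fun f => by
    simp only [Pi.sub_apply, mul_sub]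
    rw [integral_sub (integrable_lipB_mul f hv.2.1) (integrable_lipB_mul f hw.2.1), sub_eq_zero]
    exact neg_injective ((hv.2.2 f).symm.trans (hw.2.2 f))
  filter_upwards [h] with x hx
  exact sub_eq_zero.1 hx

theorem divergence_pushDer {b : Der m} (hb : b ∈ divDomain m) :
    divergence (pushDer b) = pushL0 (divergence b) := by
  refine pullL0_injective (m := m) ?_
  rw [pullL0_pushL0]
  exact (isDivergence_pushDer_iff.1 (isDivergence_divergence (pushDer_mem_divDomain_iff.2 hb))).unique
    (isDivergence_divergence hb)

end Divergence

/-! ### Boundedness of Weaver derivations -/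

section Weaver

/-- Banach-Steinhaus on `L¹(m)` bounds the functionals `v ↦ ∫ v u_n` uniformly. Testing on
indicators gives `|∫_E u_n| ≤ C m(E)`, hence the pointwise bound. -/
theorem exists_forall_ae_abs_le_of_weakly_bounded {X : Type*} [MeasurableSpace X] {m : Measure X}
    [IsFiniteMeasure m] {u : ℕ → X → ℝ} (hu : ∀ n, MemLp (u n) ∞ m)
    (h : ∀ v : X → ℝ, Integrable v m → ∃ M, ∀ n, |∫ x, v x * u n x ∂m| ≤ M) :
    ∃ C : ℝ, ∀ n, ∀ᵐ x ∂m, |u n x| ≤ C := by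
  set Λ : ℕ → Lp ℝ 1 m →L[ℝ] ℝ := fun n =>
    (ContinuousLinearMap.mul ℝ ℝ).lpPairing m ∞ 1 (hu n).toLp
  have hΛ : ∀ n (v : Lp ℝ 1 m), Λ n v = ∫ x, v x * u n x ∂m := fun n v => by
    simp only [Λ]
    rw [ContinuousLinearMap.lpPairing_eq_integral]
    refine integral_congr_ae ?_
    filter_upwards [(hu n).coeFn_toLp] with x hx
    rw [hx, ContinuousLinearMap.mul_apply', mul_comm]
  obtain ⟨C, hC⟩ := banach_steinhaus (g := Λ) fun v => by
    obtain ⟨M, hM⟩ := h v (L1.integrable_coeFn v)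
    exact ⟨M, fun n => by rw [hΛ]; exact hM n⟩
  have hE : ∀ n (E : Set X), MeasurableSet E → |∫ x in E, u n x ∂m| ≤ C * m.real E :=
    fun n E hE => by
      have h1 := (Λ n).le_of_opNorm_le (hC n) (indicatorConstLp 1 hE (measure_ne_top m E) (1 : ℝ))
      rw [hΛ, norm_indicatorConstLp one_ne_zero ENNReal.one_ne_top] at h1
      have h2 : ∫ x, indicatorConstLp 1 hE (measure_ne_top m E) (1 : ℝ) x * u n x ∂m =
          ∫ x in E, u n x ∂m := by
        rw [← integral_indicator hE]
        refine integral_congr_ae ?_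
        filter_upwards [indicatorConstLp_coeFn (p := 1) (hs := hE) (hμs := measure_ne_top m E)
          (c := (1 : ℝ))] with x hx
        rw [hx]
        by_cases hxE : x ∈ E <;> simp [hxE]
      rw [h2] at h1
      simpa using h1
  have hint : ∀ n, Integrable (u n) m := fun n => (hu n).integrable le_top
  refine ⟨C, fun n => ?_⟩
  have h1 : u n ≤ᵐ[m] fun _ => C :=
    ae_le_of_forall_setIntegral_le (hint n) (integrable_const C) fun E hEm _ => by
      rw [setIntegral_const, smul_eq_mul, mul_comm]
      exact (le_abs_self _).trans (hE n E hEm)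
  have h2 : (fun _ => -C) ≤ᵐ[m] u n :=
    ae_le_of_forall_setIntegral_le (integrable_const _) (hint n) fun E hEm _ => by
      rw [setIntegral_const, smul_eq_mul, mul_comm, neg_mul]
      exact (abs_le.1 (hE n E hEm)).1
  filter_upwards [h1, h2] with x hx1 hx2
  exact abs_le.2 ⟨hx2, hx1⟩

variable {X : Type*} [TopologicalSpace X] [EDist X]

theorem lipNorm_nonneg (f : lipB X) : 0 ≤ lipNorm f :=
  add_nonneg ENNReal.toReal_nonneg (norm_nonneg _)

theorem lipNorm_smul_le (r : ℝ) (f : lipB X) : lipNorm (r • f) ≤ |r| * lipNorm f := by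
  have h1 : lipConst ((r • f : lipB X) : X →ᵇ ℝ) ≤ ‖r‖₊ * lipConst (f : X →ᵇ ℝ) := by
    refine iSup₂_le fun x hx => iSup₂_le fun y hy => iSup_le fun hne => ?_
    have h2 := edist_smul₀ r ((f : X →ᵇ ℝ) x) ((f : X →ᵇ ℝ) y)
    calc edist (r • (f : X →ᵇ ℝ) x) (r • (f : X →ᵇ ℝ) y) / edist x y
        = ‖r‖₊ * (edist ((f : X →ᵇ ℝ) x) ((f : X →ᵇ ℝ) y) / edist x y) := by
          rw [h2, ENNReal.smul_def, smul_eq_mul, mul_div_assoc]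
      _ ≤ ‖r‖₊ * lipConst (f : X →ᵇ ℝ) := by
          gcongr
          exact le_iSup₂_of_le x hx (le_iSup₂_of_le y hy
            (le_iSup (fun _ : x ≠ y => edist ((f : X →ᵇ ℝ) x) ((f : X →ᵇ ℝ) y) / edist x y) hne))
  have h3 : (lipConst ((r • f : lipB X) : X →ᵇ ℝ)).toReal ≤
      |r| * (lipConst (f : X →ᵇ ℝ)).toReal := by
    refine (ENNReal.toReal_mono (ENNReal.mul_ne_top ENNReal.coe_ne_top (lipConst_lt_top f).ne)
      h1).trans_eq ?_
    rw [ENNReal.toReal_mul]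
    rfl
  have h4 : ‖((r • f : lipB X) : X →ᵇ ℝ)‖ = |r| * ‖(f : X →ᵇ ℝ)‖ := norm_smul r (f : X →ᵇ ℝ)
  rw [lipNorm, lipNorm, h4, mul_add]
  gcongr

variable [MeasurableSpace X] [BorelSpace X] {m : Measure X}

theorem ae_abs_smul_apply (b : Der m) (r : ℝ) (f : lipB X) :
    ∀ᵐ x ∂m, |b (r • f) x| = |r| * |b f x| := by
  rw [Derivation.map_smul]
  filter_upwards [AEEqFun.coeFn_smul r (b f)] with x hx
  rw [hx, Pi.smul_apply, smul_eq_mul, abs_mul]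

/-- Otherwise some `f n` in the unit ball have `|b (f n)| > (n + 1)²` on a nonnull set. Then `f n /
(n + 1)` tends to 0 inside the ball, so its images converge weak* and are bounded in `L^∞(m)`,
although they exceed `n + 1` on nonnull sets. -/
theorem exists_bound_of_mem_weaver [IsFiniteMeasure m] {b : Der m} (hb : b ∈ weaver m) :
    ∃ C : ℝ, 0 ≤ C ∧ ∀ f : lipB X, lipNorm f ≤ 1 → ∀ᵐ x ∂m, |b f x| ≤ C := by
  obtain ⟨h1, h2⟩ := hb
  by_contra! hcon
  have hex : ∀ n : ℕ, ∃ f : lipB X, lipNorm f ≤ 1 ∧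
      ¬∀ᵐ x ∂m, |b f x| ≤ ((n : ℝ) + 1) ^ 2 := fun n => by
    obtain ⟨f, hf, h⟩ := hcon (((n : ℝ) + 1) ^ 2) (by positivity)
    refine ⟨f, hf, ?_⟩
    rw [not_eventually]
    simpa only [not_le] using h
  choose f hf hfb using hex
  set F : ℕ → lipB X := fun n => (((n : ℝ) + 1)⁻¹ : ℝ) • f n
  have hinv : ∀ n : ℕ, |(((n : ℝ) + 1)⁻¹ : ℝ)| = ((n : ℝ) + 1)⁻¹ := fun n =>
    abs_of_nonneg (by positivity)
  have hF : ∀ n, lipNorm (F n) ≤ ((n : ℝ) + 1)⁻¹ := fun n => by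
    refine (lipNorm_smul_le _ _).trans ?_
    rw [hinv]
    exact mul_le_of_le_one_right (by positivity) (hf n)
  have hF1 : ∀ n, lipNorm (F n) ≤ 1 := fun n => (hF n).trans (inv_le_one_of_one_le₀ (by simp))
  have h01 : lipNorm (0 : lipB X) ≤ 1 := by
    have := lipNorm_smul_le (0 : ℝ) (0 : lipB X)
    rw [zero_smul, abs_zero, zero_mul] at this
    linarith
  have hlim : ∀ x, Tendsto (fun n => (F n : X →ᵇ ℝ) x) atTop (𝓝 (((0 : lipB X) : X →ᵇ ℝ) x)) :=
    fun x => by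
      change Tendsto _ _ (𝓝 0)
      refine squeeze_zero_norm (fun n => ?_) (tendsto_one_div_add_atTop_nhds_zero_nat (𝕜 := ℝ))
      rw [one_div]
      exact ((F n : X →ᵇ ℝ).norm_coe_le_norm x).trans
        ((le_add_of_nonneg_left ENNReal.toReal_nonneg).trans (hF n))
  obtain ⟨C, hC⟩ := exists_forall_ae_abs_le_of_weakly_bounded (u := fun n => b (F n))
    (fun n => h1 _) fun v hv => by
      obtain ⟨M, hM⟩ := (h2 F 0 hF1 h01 hlim v hv).abs.bddAbove_range
      exact ⟨M, fun n => hM ⟨n, rfl⟩⟩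
  obtain ⟨n, hn⟩ := exists_nat_ge C
  refine hfb n ?_
  filter_upwards [hC n, ae_abs_smul_apply b ((n : ℝ) + 1)⁻¹ (f n)] with x hx1 hx2
  rw [hx2, hinv, inv_mul_le_iff₀ (by positivity)] at hx1
  have hn1 : (0 : ℝ) < n + 1 := by positivity
  nlinarith

theorem nonempty_weaverBounds [IsFiniteMeasure m] {b : Der m} (hb : b ∈ weaver m) :
    (weaverBounds b).Nonempty := by
  obtain ⟨C, hC0, hC⟩ := exists_bound_of_mem_weaver hb
  refine ⟨AEEqFun.const X C, ?_, ?_, fun f => ?_⟩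
  · exact AEEqFun.coeFn_le.1 <| by
      filter_upwards [AEEqFun.coeFn_const X C (μ := m),
        AEEqFun.coeFn_zero (β := ℝ) (μ := m)] with x h1 h2
      rw [h1, h2]
      exact hC0
  · exact (memLp_const C).ae_eq (AEEqFun.coeFn_const X C).symm
  · rcases (lipNorm_nonneg f).eq_or_lt with h0 | h0
    · have hf : f = 0 := by
        refine Subtype.ext (norm_le_zero_iff.1 ?_)
        rw [h0]
        exact le_add_of_nonneg_left ENNReal.toReal_nonneg
      rw [← h0, hf, map_zero]
      filter_upwards [AEEqFun.coeFn_zero (β := ℝ) (μ := m)] with x hx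
      simp [hx]
    · have h1 : lipNorm ((lipNorm f)⁻¹ • f) ≤ 1 := by
        refine (lipNorm_smul_le _ _).trans_eq ?_
        rw [abs_of_pos (inv_pos.2 h0), inv_mul_cancel₀ h0.ne']
      filter_upwards [hC _ h1, ae_abs_smul_apply b (lipNorm f)⁻¹ f,
        AEEqFun.coeFn_const X C (μ := m)] with x h2 h3 h4
      rw [h3, abs_of_pos (inv_pos.2 h0), inv_mul_le_iff₀ h0] at h2
      rw [h4, Function.const_apply, mul_comm]
      exact h2

theorem weaverNorm_pushDer [EMTSpace X] [IsFiniteMeasure m] [m.InnerRegular] {b : Der m}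
    (hb : b ∈ weaver m) : weaverNorm (pushDer b) = pushL0 (weaverNorm b) := by
  have h1 := isGLB_weaverNorm (nonempty_weaverBounds hb)
  have h2 := isGLB_weaverNorm (nonempty_weaverBounds (pushDer_mem_weaver hb))
  refine le_antisymm (le_pushL0_iff.2 (h1.2 fun g hg => ?_)) (h2.2 fun g hg => ?_)
  · rw [← le_pushL0_iff]
    exact h2.1 (mem_weaverBounds_pushDer_iff.2 (by rwa [pullL0_pushL0]))
  · exact pushL0_le_iff.2 (h1.1 (mem_weaverBounds_pushDer_iff.1 hg))

end Weaver

/-! ### Di Marino derivations -/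

section DiMarino

/-- If the exceptional set were nonnull, inner regularity would place in it a compact set of
positive measure, contradicting `h`. No countable cover is needed. -/
theorem ae_of_forall_isCompact {X : Type*} [TopologicalSpace X] [MeasurableSpace X]
    {m : Measure X} [m.InnerRegular] {A : Set X} (hA : MeasurableSet A)
    {p : X → Prop} (hp : MeasurableSet {x | p x})
    (h : ∀ K ⊆ A, IsCompact K → ∀ᵐ x ∂m, x ∈ K → p x) : ∀ᵐ x ∂m, x ∈ A → p x := by
  have hN : MeasurableSet (A \ {x | p x}) := hA.diff hp
  have h0 : m (A \ {x | p x}) = 0 := by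
    by_contra hne
    obtain ⟨K, hK, hKc, hlt⟩ := hN.exists_lt_isCompact (pos_iff_ne_zero.2 hne)
    refine hlt.ne' (measure_eq_zero_iff_ae_notMem.2 ?_)
    filter_upwards [h K (hK.trans Set.sdiff_subset) hKc] with x hx hxK
    exact (hK hxK).2 (hx hxK)
  filter_upwards [measure_eq_zero_iff_ae_notMem.1 h0] with x hx hxA
  by_contra hpx
  exact hx ⟨hxA, hpx⟩

variable {X : Type*} [TopologicalSpace X] [EDist X] [MeasurableSpace X] [BorelSpace X]
  {m : Measure X}

theorem ae_sub_apply (b : Der m) (f g : lipB X) : ∀ᵐ x ∂m, b (f - g) x = b f x - b g x := by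
  have h : b f = b (f - g) + b g :=
    (congrArg b (Subtype.ext (sub_add_cancel (f : X →ᵇ ℝ) (g : X →ᵇ ℝ)).symm)).trans (map_add b _ _)
  filter_upwards [AEEqFun.coeFn_add (b (f - g)) (b g)] with x hx
  rw [h, hx, Pi.add_apply, add_sub_cancel_right]

theorem ae_neg_apply (b : Der m) (f : lipB X) : ∀ᵐ x ∂m, b (-f) x = -b f x := by
  rw [← neg_one_smul ℝ f, Derivation.map_smul]
  filter_upwards [AEEqFun.coeFn_smul (-1 : ℝ) (b f)] with x hx
  rw [hx, Pi.smul_apply, neg_one_smul]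

variable [EMTSpace X] [IsFiniteMeasure m] [m.InnerRegular]

/-- A derivation with divergence, bounded by an integrable multiple of the Lipschitz constant, is
weakly continuous along uniformly vanishing equi-Lipschitz functions. -/
theorem exists_abs_setIntegral_le {b : Der m} (hb : b ∈ divDomain m) {g : X → ℝ}
    (hg : Integrable g m)
    (hbg : ∀ (f : lipB X) (L : ℝ≥0), (f : X →ᵇ ℝ) ∈ lipBall X L → ∀ᵐ x ∂m, |b f x| ≤ g x * L)
    (L : ℝ≥0) {E : Set X} (hE : MeasurableSet E) {η : ℝ} (hη : 0 < η) :
    ∃ δ : ℝ, 0 < δ ∧ ∀ t : lipB X, (t : X →ᵇ ℝ) ∈ lipBall X L →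
      (∀ x, |(t : X →ᵇ ℝ) x| ≤ δ) → |∫ x in E, b t x ∂m| ≤ η := by
  obtain ⟨v, hint, hv, hdiv⟩ := hb
  obtain ⟨h, h01, hh⟩ := exists_lipB_integral_indicator_sub_lt hE (hg.mul_const (L : ℝ))
    (half_pos hη)
  set I := ∫ x, |v x| ∂m + ∫ x, |b h x| ∂m
  have hI : 0 ≤ I := add_nonneg (integral_nonneg fun _ => abs_nonneg _)
    (integral_nonneg fun _ => abs_nonneg _)
  -- The function `h` is fixed before `δ`, since `I` involves `b h`; both are independent of `t`.
  refine ⟨η / (2 * (I + 1)), by positivity, fun t ht htδ => ?_⟩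
  set δ := η / (2 * (I + 1))
  have hδ0 : 0 < δ := by positivity
  have h1 : |∫ x in E, b t x ∂m - ∫ x, (h : X →ᵇ ℝ) x * b t x ∂m| ≤ η / 2 := by
    refine (abs_setIntegral_sub_integral_lipB_mul_le hE h (hint t)).trans (le_trans ?_ hh.le)
    have hi : Integrable (fun x => |E.indicator 1 x - (h : X →ᵇ ℝ) x| * |g x * L|) m := by
      refine (hg.mul_const (L : ℝ)).abs.bdd_mul (c := 1) ?_ (Eventually.of_forall fun x => ?_)
      · exact (((measurable_one.indicator hE).sub
          (h : X →ᵇ ℝ).continuous.measurable).abs).aestronglyMeasurable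
      · obtain ⟨ha, hb⟩ := h01 x
        rw [Real.norm_eq_abs, abs_abs, abs_le]
        by_cases hxE : x ∈ E
        · rw [Set.indicator_of_mem hxE, Pi.one_apply]
          constructor <;> linarith
        · rw [Set.indicator_of_notMem hxE]
          constructor <;> linarith
    refine integral_mono_of_nonneg (Eventually.of_forall fun x => by positivity) hi ?_
    filter_upwards [hbg t L ht] with x hx
    exact mul_le_mul_of_nonneg_left (hx.trans (le_abs_self _)) (abs_nonneg _)
  -- Integration by parts: the divergence identity for `h * t`, expanded by Leibniz, moves the
  -- derivation off `t`.
  have h2 : ∫ x, (h : X →ᵇ ℝ) x * b t x ∂m =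
      -∫ x, (t : X →ᵇ ℝ) x * ((h : X →ᵇ ℝ) x * v x + b h x) ∂m := by
    have e1 : ∫ x, b (h * t) x ∂m =
        ∫ x, (h : X →ᵇ ℝ) x * b t x ∂m + ∫ x, (t : X →ᵇ ℝ) x * b h x ∂m := by
      rw [← integral_add (integrable_lipB_mul h (hint t)) (integrable_lipB_mul t (hint h))]
      refine integral_congr_ae ?_
      rw [Derivation.leibniz, lip_smul_def, lip_smul_def]
      filter_upwards [AEEqFun.coeFn_add (lipToL0 h * b t) (lipToL0 t * b h),
        AEEqFun.coeFn_mul (lipToL0 h) (b t), AEEqFun.coeFn_mul (lipToL0 t) (b h),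
        AEEqFun.coeFn_mk (μ := m) (h : X →ᵇ ℝ) (h : X →ᵇ ℝ).continuous.aestronglyMeasurable,
        AEEqFun.coeFn_mk (μ := m) (t : X →ᵇ ℝ) (t : X →ᵇ ℝ).continuous.aestronglyMeasurable]
        with x k1 k2 k3 k4 k5
      rw [k1, Pi.add_apply, k2, k3, Pi.mul_apply, Pi.mul_apply]
      exact congrArg₂ (· + ·) (congrArg (· * _) k4) (congrArg (· * _) k5)
    have e2 : ∫ x, (t : X →ᵇ ℝ) x * ((h : X →ᵇ ℝ) x * v x + b h x) ∂m =
        ∫ x, ((h * t : lipB X) : X →ᵇ ℝ) x * v x ∂m + ∫ x, (t : X →ᵇ ℝ) x * b h x ∂m := by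
      rw [← integral_add (integrable_lipB_mul (h * t) hv) (integrable_lipB_mul t (hint h))]
      refine integral_congr_ae (Eventually.of_forall fun x => ?_)
      change _ = ((h : X →ᵇ ℝ) x * (t : X →ᵇ ℝ) x) * v x + (t : X →ᵇ ℝ) x * b h x
      ring
    rw [e2]
    linarith [hdiv (h * t)]
  have h3 : |∫ x, (h : X →ᵇ ℝ) x * b t x ∂m| ≤ η / 2 := by
    rw [h2, abs_neg]
    have hi : Integrable (fun x => δ * (|v x| + |b h x|)) m :=
      (hv.abs.add (hint h).abs).const_mul δ
    calc |∫ x, (t : X →ᵇ ℝ) x * ((h : X →ᵇ ℝ) x * v x + b h x) ∂m|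
        ≤ ∫ x, |(t : X →ᵇ ℝ) x * ((h : X →ᵇ ℝ) x * v x + b h x)| ∂m :=
          abs_integral_le_integral_abs
      _ ≤ ∫ x, δ * (|v x| + |b h x|) ∂m := by
          refine integral_mono_of_nonneg (Eventually.of_forall fun x => abs_nonneg _) hi
            (Eventually.of_forall fun x => ?_)
          simp only
          rw [abs_mul]
          refine mul_le_mul (htδ x) ((abs_add_le _ _).trans ?_) (abs_nonneg _) hδ0.le
          rw [abs_mul, abs_of_nonneg (h01 x).1]
          gcongr
          exact mul_le_of_le_one_left (abs_nonneg _) (h01 x).2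
      _ = δ * I := by rw [integral_const_mul, integral_add hv.abs (hint h).abs]
      _ ≤ η / 2 := by
          simp only [δ]
          rw [div_mul_eq_mul_div, div_le_div_iff₀ (by positivity) two_pos]
          nlinarith
  have h4 := abs_add_le (∫ x in E, b t x ∂m - ∫ x, (h : X →ᵇ ℝ) x * b t x ∂m)
    (∫ x, (h : X →ᵇ ℝ) x * b t x ∂m)
  rw [sub_add_cancel] at h4
  linarith

/-- A derivation on `X` whose push-forward is a Di Marino derivation is bounded by the global
Lipschitz constant. -/
theorem ae_abs_le_of_mem_lipBall {b : Der m} {g : Compactification X →ₘ[hatMeasure m] ℝ}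
    (hg : g ∈ diMarinoBounds (pushDer b)) (f : lipB X) (L : ℝ≥0)
    (hf : (f : X →ᵇ ℝ) ∈ lipBall X L) : ∀ᵐ x ∂m, |b f x| ≤ pullL0 g x * L := by
  have h0 : 0 ≤ pullL0 g := by
    rw [← map_zero pullL0, pullL0_le_pullL0_iff]
    exact hg.1
  have h1 := (pushDer_bound_iff b (gelfand f) g (measurable_slope _)).1 (hg.2 (gelfand f))
  rw [pullLip_gelfand] at h1
  filter_upwards [h1, AEEqFun.coeFn_le.2 h0, AEEqFun.coeFn_zero (β := ℝ) (μ := m)] with x h2 h3 h4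
  rw [h4] at h3
  refine h2.trans (mul_le_mul_of_nonneg_left ?_ h3)
  refine (slope_le_lipOn (gelfand f) isOpen_univ (Set.mem_univ (emb x))).trans ?_
  change (lipConst (gelfand f : Compactification X →ᵇ ℝ)).toReal ≤ _
  rw [← lipConst_pullLip, pullLip_gelfand]
  exact ENNReal.toReal_mono ENNReal.coe_ne_top (lipConst_le hf)

/-- The difference `F - truncate F ε` vanishes on the open subset `|F| < ε` of `X̂`. Its slope is
therefore 0 there, and the Di Marino bound kills its derivative. -/
theorem ae_truncate_eq {b : Der m} {g : Compactification X →ₘ[hatMeasure m] ℝ}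
    (hg : g ∈ diMarinoBounds (pushDer b)) (f : lipB X) (ε : ℝ) :
    ∀ᵐ x ∂m, |(f : X →ᵇ ℝ) x| < ε → b (truncate f ε) x = b f x := by
  set F := gelfand f
  set D := F - truncate F ε
  have hD : pullLip D = f - truncate f ε := rfl
  have h1 := (pushDer_bound_iff b D g (measurable_slope _)).1 (hg.2 D)
  rw [hD] at h1
  filter_upwards [h1, ae_sub_apply b f (truncate f ε)] with x h2 h3 hx
  set U : Set (Compactification X) := {φ | |(F : Compactification X →ᵇ ℝ) φ| < ε}
  have hU : IsOpen U :=
    isOpen_lt (F : Compactification X →ᵇ ℝ).continuous.abs continuous_const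
  have hDU : ∀ φ ∈ U, (D : Compactification X →ᵇ ℝ) φ = 0 := fun φ hφ => by
    change (F : Compactification X →ᵇ ℝ) φ - (truncate F ε : Compactification X →ᵇ ℝ) φ = 0
    rw [truncate_eq_of_abs_lt hφ, sub_self]
  have h4 : slope D (emb x) = 0 := by
    refine le_antisymm ((slope_le_lipOn D hU hx).trans_eq ?_) (slope_nonneg _ _)
    rw [ENNReal.toReal_eq_zero_iff]
    left
    refine le_antisymm (iSup₂_le fun φ hφ => iSup₂_le fun ψ hψ => iSup_le fun _ => ?_) zero_le
    rw [hDU φ hφ, hDU ψ hψ, edist_self, ENNReal.zero_div]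
  rw [h4, mul_zero, abs_nonpos_iff, h3, sub_eq_zero] at h2
  exact h2.symm

theorem ae_le_on_isCompact {b : Der m} (hb : b ∈ divDomain m)
    {g : Compactification X →ₘ[hatMeasure m] ℝ} (hg : g ∈ diMarinoBounds (pushDer b))
    (hgi : Integrable (pullL0 g) m) (f : lipB X) {c : ℝ≥0} (hc : c ≠ 0) {K : Set X}
    (hK : IsCompact K)
    (hf : ∀ x ∈ K, ∀ y ∈ K, edist ((f : X →ᵇ ℝ) x) ((f : X →ᵇ ℝ) y) ≤ c * edist x y) :
    ∀ᵐ x ∂m, x ∈ K → b f x ≤ pullL0 g x * c := by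
  have hint := fun f => (show ∃ v, IsDivergence b v from hb).choose_spec.1 f
  obtain ⟨Lf, hLf⟩ := f.2
  rw [← ae_restrict_iff' hK.measurableSet]
  refine ae_le_of_forall_setIntegral_le (hint f).restrict (hgi.mul_const (c : ℝ)).restrict
    fun E hE _ => le_of_forall_pos_le_add fun η hη => ?_
  rw [Measure.restrict_restrict hE]
  have hA : MeasurableSet (E ∩ K) := hE.inter hK.measurableSet
  -- The Lipschitz constant `Lf + c` of `f - w` does not depend on how close `w` is to `f` on `K`,
  -- so `δ` can be fixed before `w` is chosen.
  obtain ⟨δ, hδ, hδt⟩ := exists_abs_setIntegral_le hb hgi (ae_abs_le_of_mem_lipBall hg) (Lf + c)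
    hA hη
  obtain ⟨w, hw, hwf⟩ := exists_mem_lipBall_abs_sub_lt hK
    (f : X →ᵇ ℝ).continuous.continuousOn hc hf hδ
  set W : lipB X := ⟨w, mem_lipB_of_mem_lipBall hw⟩
  have hfw : ((f - W : lipB X) : X →ᵇ ℝ) ∈ lipBall X (Lf + c) := by
    change (f : X →ᵇ ℝ) - w ∈ _
    rw [sub_eq_add_neg]
    exact add_mem_lipBall hLf (neg_mem_lipBall hw)
  have h1 := hδt (truncate (f - W) δ) (truncate_mem_lipBall hfw δ) (abs_truncate_le _ hδ.le)
  -- On `K` the truncation at height `δ` does not affect `f - W`, so `b` does not see it there.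
  have h2 : ∫ x in E ∩ K, b f x ∂m =
      ∫ x in E ∩ K, b W x ∂m + ∫ x in E ∩ K, b (truncate (f - W) δ) x ∂m := by
    rw [← integral_add (hint _).restrict (hint _).restrict]
    refine setIntegral_congr_ae hA ?_
    filter_upwards [ae_truncate_eq hg (f - W) δ, ae_sub_apply b f W] with x hx1 hx2 hx
    have : |((f - W : lipB X) : X →ᵇ ℝ) x| < δ := by
      change |(f : X →ᵇ ℝ) x - w x| < δ
      rw [abs_sub_comm]
      exact hwf x hx.2
    rw [hx1 this, hx2]
    ring
  have h3 : ∫ x in E ∩ K, b W x ∂m ≤ ∫ x in E ∩ K, pullL0 g x * c ∂m := by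
    refine integral_mono_ae (hint W).restrict (hgi.mul_const (c : ℝ)).restrict
      (ae_restrict_of_ae ?_)
    filter_upwards [ae_abs_le_of_mem_lipBall hg W c hw] with x hx
    exact (le_abs_self _).trans hx
  linarith [le_abs_self (∫ x in E ∩ K, b (truncate (f - W) δ) x ∂m)]

theorem ae_abs_le_on_isCompact {b : Der m} (hb : b ∈ divDomain m)
    {g : Compactification X →ₘ[hatMeasure m] ℝ} (hg : g ∈ diMarinoBounds (pushDer b))
    (hgi : Integrable (pullL0 g) m) (f : lipB X) {c : ℝ≥0} (hc : c ≠ 0) {K : Set X}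
    (hK : IsCompact K)
    (hf : ∀ x ∈ K, ∀ y ∈ K, edist ((f : X →ᵇ ℝ) x) ((f : X →ᵇ ℝ) y) ≤ c * edist x y) :
    ∀ᵐ x ∂m, x ∈ K → |b f x| ≤ pullL0 g x * c := by
  have h1 := ae_le_on_isCompact hb hg hgi f hc hK hf
  have h2 := ae_le_on_isCompact hb hg hgi (-f) hc hK fun x hx y hy =>
    (edist_neg_neg ((f : X →ᵇ ℝ) x) ((f : X →ᵇ ℝ) y)).trans_le (hf x hx y hy)
  filter_upwards [h1, h2, ae_neg_apply b f] with x h3 h4 h5 hx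
  have h6 := h4 hx
  rw [h5] at h6
  exact abs_le.2 ⟨by linarith, h3 hx⟩

/-- A Di Marino bound on the compactification that is integrable descends to `X`, for derivations
with divergence. -/
theorem pullL0_mem_diMarinoBounds {b : Der m} (hb : b ∈ divDomain m)
    {g : Compactification X →ₘ[hatMeasure m] ℝ} (hg : g ∈ diMarinoBounds (pushDer b))
    (hgi : Integrable (pullL0 g) m) : pullL0 g ∈ diMarinoBounds b := by
  have h0 : 0 ≤ pullL0 g := by
    rw [← map_zero pullL0, pullL0_le_pullL0_iff]
    exact hg.1
  refine ⟨h0, fun f => ?_⟩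
  have hp : ∀ c : ℝ≥0, MeasurableSet {x | |b f x| ≤ pullL0 g x * c} := fun c =>
    measurableSet_le (b f).measurable.abs ((pullL0 g).measurable.mul_const _)
  have hU : ∀ c : ℝ≥0, c ≠ 0 → ∀ U : Set X, IsOpen U → lipOn (f : X →ᵇ ℝ) U ≤ c →
      ∀ᵐ x ∂m, x ∈ U → |b f x| ≤ pullL0 g x * c := fun c hc U hU hUc =>
    ae_of_forall_isCompact hU.measurableSet (hp c) fun K hKU hK =>
      ae_abs_le_on_isCompact hb hg hgi f hc hK fun x hx y hy =>
        edist_le_of_lipOn_le hc hUc (hKU hx) (hKU hy)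
  have hA : ∀ c : ℝ≥0, ∀ᵐ x ∂m, slope f x < c → |b f x| ≤ pullL0 g x * c := fun c => by
    rcases eq_or_ne c 0 with rfl | hc
    · exact Eventually.of_forall fun x hx =>
        absurd hx (by simpa using slope_nonneg f x)
    -- The sublevel set is a union of open sets on which `f` is `c`-Lipschitz, possibly without a
    -- countable subcover. A compact subset needs only finitely many of them.
    refine ae_of_forall_isCompact (A := {x | slope f x < c}) (isOpen_slope_lt f c).measurableSet
      (hp c) fun K hKA hK => ?_
    refine hK.induction_on (p := fun s => ∀ᵐ x ∂m, x ∈ s → |b f x| ≤ pullL0 g x * c) ?_ ?_ ?_ ?_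
    · simp
    · exact fun s t hst ht => ht.mono fun x hx hxs => hx (hst hxs)
    · intro s t hs ht
      filter_upwards [hs, ht] with x h1 h2
      rintro (h | h)
      exacts [h1 h, h2 h]
    · intro x hx
      obtain ⟨U, hUo, hxU, hlt⟩ := (slope_lt_iff f x).1 (hKA hx)
      exact ⟨U, mem_nhdsWithin_of_mem_nhds (hUo.mem_nhds hxU), hU c hc U hUo hlt.le⟩
  -- Rational constants leave countably many null sets and still approximate the slope from above.
  have hall : ∀ᵐ x ∂m, ∀ q : ℚ, slope f x < (Real.toNNReal q : ℝ≥0) →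
      |b f x| ≤ pullL0 g x * (Real.toNNReal q : ℝ≥0) := ae_all_iff.2 fun q => hA _
  filter_upwards [hall, AEEqFun.coeFn_le.2 h0, AEEqFun.coeFn_zero (β := ℝ) (μ := m)]
    with x h1 h2 h3
  rw [h3] at h2
  have hq : ∀ q : ℚ, slope f x < q → |b f x| ≤ pullL0 g x * q := fun q hq => by
    have e : ((Real.toNNReal q : ℝ≥0) : ℝ) = q :=
      Real.coe_toNNReal _ ((slope_nonneg f x).trans hq.le)
    have := h1 q
    rw [e] at this
    exact this hq
  rcases h2.eq_or_lt with h4 | h4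
  · obtain ⟨q, hq1⟩ := exists_rat_gt (slope f x)
    have := hq q hq1
    rw [← h4] at this ⊢
    simpa using this
  · by_contra! hlt
    rw [mul_comm, ← lt_div_iff₀ h4] at hlt
    obtain ⟨q, hq1, hq2⟩ := exists_rat_btwn hlt
    rw [lt_div_iff₀ h4, mul_comm] at hq2
    exact (hq q hq1).not_gt hq2

theorem pushL0_mem_diMarinoBounds {b : Der m} {g : X →ₘ[m] ℝ} (hg : g ∈ diMarinoBounds b) :
    pushL0 g ∈ diMarinoBounds (pushDer b) :=
  mem_diMarinoBounds_pushDer_of_pullL0 (by rwa [pullL0_pushL0])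

theorem memLp_pushL0_iff {u : X →ₘ[m] ℝ} {q : ℝ≥0∞} :
    MemLp (pushL0 u) q (hatMeasure m) ↔ MemLp u q m := by
  rw [← memLp_pullL0_iff, pullL0_pushL0]

theorem pushDer_mem_der0 {b : Der m} (hb : b ∈ der0 m) : pushDer b ∈ der0 (hatMeasure m) := by
  obtain ⟨g, hg⟩ := hb
  exact ⟨_, pushL0_mem_diMarinoBounds hg⟩

theorem diMarinoNorm_pushDer_le {b : Der m} (hb : b ∈ der0 m) :
    diMarinoNorm (pushDer b) ≤ pushL0 (diMarinoNorm b) := by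
  refine le_pushL0_iff.2 ((isGLB_diMarinoNorm hb).2 fun g hg => ?_)
  rw [← le_pushL0_iff]
  exact (isGLB_diMarinoNorm (pushDer_mem_der0 hb)).1 (pushL0_mem_diMarinoBounds hg)

theorem pushDer_mem_derQ {b : Der m} {q : ℝ≥0∞} (hb : b ∈ derQ m q) :
    pushDer b ∈ derQ (hatMeasure m) q := by
  obtain ⟨g, hg, hgq⟩ := hb
  exact ⟨_, pushL0_mem_diMarinoBounds hg, memLp_pushL0_iff.2 hgq⟩

theorem pushDer_mem_derQR {b : Der m} {q r : ℝ≥0∞} (hb : b ∈ derQR m q r) :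
    pushDer b ∈ derQR (hatMeasure m) q r := by
  obtain ⟨hq, hd, hr⟩ := hb
  refine ⟨pushDer_mem_derQ hq, pushDer_mem_divDomain_iff.2 hd, ?_⟩
  rwa [divergence_pushDer hd, memLp_pushL0_iff]

theorem pushDer_mem_derQR_iff {b : Der m} {q r : ℝ≥0∞} (hq : 1 ≤ q) :
    pushDer b ∈ derQR (hatMeasure m) q r ↔ b ∈ derQR m q r := by
  refine ⟨?_, pushDer_mem_derQR⟩
  rintro ⟨⟨g, hg, hgq⟩, hd, hr⟩
  have hd' := pushDer_mem_divDomain_iff.1 hd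
  have hgq' : MemLp (pullL0 g) q m := memLp_pullL0_iff.2 hgq
  -- As `m` is finite, `q ≥ 1` makes the bound integrable.
  refine ⟨⟨pullL0 g, pullL0_mem_diMarinoBounds hd' hg (hgq'.integrable hq), hgq'⟩, hd', ?_⟩
  rwa [divergence_pushDer hd', memLp_pushL0_iff] at hr

theorem diMarinoNorm_pushDer {b : Der m} {q r : ℝ≥0∞} (hq : 1 ≤ q) (hb : b ∈ derQR m q r) :
    diMarinoNorm (pushDer b) = pushL0 (diMarinoNorm b) := by
  obtain ⟨⟨g₀, hg₀, hg₀q⟩, hd, -⟩ := hb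
  have hb0 : b ∈ der0 m := ⟨g₀, hg₀⟩
  refine le_antisymm (diMarinoNorm_pushDer_le hb0)
    ((isGLB_diMarinoNorm (pushDer_mem_der0 hb0)).2 fun g hg => ?_)
  -- An arbitrary bound `g` need not be integrable. Its minimum with the push-forward of `g₀` is
  -- again a bound, and it is dominated by an integrable one.
  have hmin := infClosed_diMarinoBounds _ hg (pushL0_mem_diMarinoBounds hg₀)
  have hle : pullL0 (g ⊓ pushL0 g₀) ≤ g₀ := by
    rw [← le_pushL0_iff]
    exact inf_le_right
  have hnn : 0 ≤ pullL0 (g ⊓ pushL0 g₀) := by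
    rw [← map_zero pullL0, pullL0_le_pullL0_iff]
    exact hmin.1
  have hint : Integrable (pullL0 (g ⊓ pushL0 g₀)) m := by
    refine (hg₀q.integrable hq).mono (AEEqFun.aestronglyMeasurable _) ?_
    filter_upwards [AEEqFun.coeFn_le.2 hle, AEEqFun.coeFn_le.2 hnn,
      AEEqFun.coeFn_zero (β := ℝ) (μ := m)] with x h1 h2 h3
    rw [h3] at h2
    rw [Real.norm_eq_abs, Real.norm_eq_abs, abs_of_nonneg h2]
    exact h1.trans (le_abs_self _)
  rw [pushL0_le_iff]
  exact ((isGLB_diMarinoNorm hb0).1 (pullL0_mem_diMarinoBounds hd hmin hint)).trans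
    (pullL0_le_pullL0_iff.2 inf_le_left)

end DiMarino

end EMT

theorem proposition4p15 {X : Type*} [TopologicalSpace X] [EDist X] [EMT.EMTSpace X]
    [MeasurableSpace X] [BorelSpace X] (m : Measure X) [IsFiniteMeasure m] [m.InnerRegular] :
    -- the push-forward is a linear bijection, and it is `L⁰`-linear
    (Function.Bijective (EMT.pushDer : EMT.Der m → EMT.Der (EMT.hatMeasure m)) ∧
      IsLinearMap ℝ (EMT.pushDer : EMT.Der m → EMT.Der (EMT.hatMeasure m)) ∧
      ∀ (h : X →ₘ[m] ℝ) (b : EMT.Der m),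
        EMT.pushDer (h • b) = EMT.pushL0 h • EMT.pushDer b) ∧
    -- i) divergence
    (EMT.pushDer '' EMT.divDomain m = EMT.divDomain (EMT.hatMeasure m) ∧
      ∀ b ∈ EMT.divDomain m,
        EMT.divergence (EMT.pushDer b) = EMT.pushL0 (EMT.divergence b)) ∧
    -- ii) Weaver derivations; the infimum defining the Weaver norm exists
    (EMT.pushDer '' EMT.weaver m ⊆ EMT.weaver (EMT.hatMeasure m) ∧
      ∀ b ∈ EMT.weaver m,
        IsGLB (EMT.weaverBounds b) (EMT.weaverNorm b) ∧
        EMT.weaverNorm (EMT.pushDer b) = EMT.pushL0 (EMT.weaverNorm b)) ∧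
    -- iii) locality
    (∀ b : EMT.Der m, EMT.IsLocal b ↔ EMT.IsLocal (EMT.pushDer b)) ∧
    -- iv) Di Marino derivations; the infimum defining the Di Marino norm exists
    (EMT.pushDer '' EMT.der0 m ⊆ EMT.der0 (EMT.hatMeasure m) ∧
      (∀ b ∈ EMT.der0 m,
        IsGLB (EMT.diMarinoBounds b) (EMT.diMarinoNorm b) ∧
        EMT.diMarinoNorm (EMT.pushDer b) ≤ EMT.pushL0 (EMT.diMarinoNorm b)) ∧
      (∀ q : ℝ≥0∞, 1 ≤ q →
        EMT.pushDer '' EMT.derQ m q ⊆ EMT.derQ (EMT.hatMeasure m) q) ∧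
      ∀ q r : ℝ≥0∞, 1 ≤ q → 1 ≤ r →
        EMT.pushDer '' EMT.derQR m q r ⊆ EMT.derQR (EMT.hatMeasure m) q r) ∧
    -- v) the case in which `τ` is metrisable on compact sets
    ((∀ K : Set X, IsCompact K → TopologicalSpace.MetrizableSpace K) →
      ∀ q : ℝ≥0∞, 1 ≤ q →
        EMT.pushDer '' EMT.derQR m q q = EMT.derQR (EMT.hatMeasure m) q q ∧
        ∀ b ∈ EMT.derQR m q q,
          EMT.diMarinoNorm (EMT.pushDer b) = EMT.pushL0 (EMT.diMarinoNorm b)) := by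
  refine ⟨⟨⟨EMT.pushDer_injective, EMT.pushDer_surjective⟩, EMT.isLinearMap_pushDer,
    EMT.pushDer_smul⟩, ⟨?_, fun b hb => EMT.divergence_pushDer hb⟩, ⟨?_, fun b hb =>
    ⟨EMT.isGLB_weaverNorm (EMT.nonempty_weaverBounds hb), EMT.weaverNorm_pushDer hb⟩⟩,
    fun b => EMT.isLocal_pushDer_iff.symm, ⟨?_, fun b hb =>
    ⟨EMT.isGLB_diMarinoNorm hb, EMT.diMarinoNorm_pushDer_le hb⟩, fun q _ => ?_, fun q r _ _ => ?_⟩,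
    fun _ q hq => ⟨?_, fun b hb => EMT.diMarinoNorm_pushDer hq hb⟩⟩
  · ext c
    obtain ⟨b, rfl⟩ := EMT.pushDer_surjective c
    rw [EMT.pushDer_injective.mem_set_image, EMT.pushDer_mem_divDomain_iff]
  · exact Set.image_subset_iff.2 fun b hb => EMT.pushDer_mem_weaver hb
  · exact Set.image_subset_iff.2 fun b hb => EMT.pushDer_mem_der0 hb
  · exact Set.image_subset_iff.2 fun b hb => EMT.pushDer_mem_derQ hb
  · exact Set.image_subset_iff.2 fun b hb => EMT.pushDer_mem_derQR hb
  · ext c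
    obtain ⟨b, rfl⟩ := EMT.pushDer_surjective c
    rw [EMT.pushDer_injective.mem_set_image, EMT.pushDer_mem_derQR_iff hq]
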